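/- **Angulated surfaces.** Let $m\ge 1$. An $(m+2)$-angulation $(P,M,T)$ is given by finitely many oriented $(m+2)$-gons some of whose sides are glued in pairs of distinct sides, reversing orientation; $P$ is the resulting compact oriented surface (not necessarily connected), $M$ is the set of images of the polygon vertices, $T$ is the set of arcs, i.e. of glued pairs of sides, and it is required that $M\subset\partial P$. Assume that every polygon has at least one side in $T$ (for connected $P$: $T\ne\emptyset$). Let $M_T\subseteq M$ be the set of marked points incident to $T$, let $\mathfrak B$ be the set of pieces of $\partial P$ that have their end points in $M_T$ and contain no other point of $M_T$, and put $w(\mathfrak b)=\#((M\cap\mathfrak b)\setminus M_T)$ for $\mathfrak b\in\mathfrak B$. Call $(P,M,T)$ non-degenerate if each polygon contains at most one element of $\mathfrak B$. **Bound quiver.** $Q_T$ has vertex set $T$ and one arrow $x\to y$ for each angle of a polygon between two consecutive sides $\tau_x,\tau_y\in T$, where $\tau_y$ follows $\tau_x$ counter-clockwise; $I_T$ is generated by the products $\alpha\beta$ of arrows given by neighbouring angles of the same polygon. Put $\Lambda=kQ_T/I_T$. **Cutting out the boundary bridges.** Let $\triangle$ be a polygon containing $s>1$ elements of $\mathfrak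 B$. Its sides in $T$ form $s$ maximal sequences $\mathfrak t_1,\dots,\mathfrak t_s$ of consecutive sides. Cutting out the boundary bridge replaces $\triangle$ by $s$ polygons: the $i$-th is an $(m+2)$-gon whose sides are those in $\mathfrak t_i$, glued as before, followed by $m+2-\#\mathfrak t_i$ sides on the new boundary. Doing this in all such polygons gives $(\tilde P,\tilde M,\tilde T)$, with $\tilde M_T,\tilde{\mathfrak B}$ defined as above; if $(P,M,T)$ is non-degenerate, then $(\tilde P,\tilde M,\tilde T)=(P,M,T)$. **AG-invariant.** Paths are composed from left to right. For a gentle bound quiver $(Q,I)$ choose $\sigma,\varepsilon\colon Q_1\to\{\pm1\}$ with $\sigma(\alpha)=-\sigma(\beta)$ if $\alpha\ne\beta$ start at the same vertex, $\varepsilon(\alpha)=-\varepsilon(\beta)$ if $\alpha\neq\beta$ end at the same vertex, and, if $\alpha$ ends where $\beta$ starts, $\sigma(\beta)=-\varepsilon(\alpha)$ if $\alpha\beta\notin I$ and $\sigma(\beta)=\varepsilon(\alpha)$ if $\alpha\beta\in I$. Non-trivial permitted threads are the maximal non-trivial paths not in $I$; non-trivial forbidden threads are the maximal non-trivial paths with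 pairwise distinct arrows in which consecutive arrows form relations; $\sigma$ of such a thread is $\sigma$ of its first arrow, $\varepsilon$ is $\varepsilon$ of its last arrow. If at most one arrow starts and at most one arrow ends at $x$, there is a trivial permitted (respectively forbidden) thread at $x$ unless there are arrows $\beta,\gamma$ with $t(\beta)=x=s(\gamma)$ and $\beta\gamma\in I$ (respectively $\beta\gamma\notin I$); it has length $0$, satisfies $\sigma=-\varepsilon$ (respectively $\sigma=\varepsilon$), and $\sigma=-\sigma(\gamma)$ if $s(\gamma)=x$, $\varepsilon=-\varepsilon(\beta)$ if $t(\beta)=x$. An isolated vertex carries two trivial permitted and two trivial forbidden threads, one for each value of $\sigma$. Starting from a permitted thread $H_0$, let $F_i$ be the forbidden thread ending where $H_i$ ends with $\varepsilon(F_i)=-\varepsilon(H_i)$ and let $H_{i+1}$ be the permitted thread starting where $F_i$ starts with $\sigma(H_{i+1})=-\sigma(F_i)$; when $H_n=H_0$ for the first time ($n\ge1$), record the pair $(n,\sum_{i<n}\ell(F_i))$. Repeat until every permitted thread has occurred. Moreover record $(0,n)$ for each oriented cycle of $n$ distinct arrows (up to rotation) in which all consecutive arrows form relations. The AG-invariant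 is the function $\mathbb N^2\to\mathbb N$ counting how often each pair is recorded. Write $(a,b)^*$ for the function with value $1$ at $(a,b)$ and $0$ elsewhere. **Theorem.** Let $(P,M,T)$ be as above, possibly degenerate or disconnected. Then $(\tilde P,\tilde M,\tilde T)$ is a non-degenerate $(m+2)$-angulation (with $\tilde P=P$ if $(P,M,T)$ is non-degenerate), the identification $T=\tilde T$ is an isomorphism $(Q_T,I_T)\cong(Q_{\tilde T},I_{\tilde T})$ of bound quivers, $(Q_T,I_T)$ is gentle, functions $\sigma,\varepsilon$ as above exist, and for every choice of them the AG-invariant of $\Lambda$ is $$t\,(0,m+2)^*+\sum_i (a_i,b_i)^*,$$ where $t$ is the number of polygons of $(P,M,T)$ all of whose sides are in $T$, the index $i$ runs over the boundary components of $\tilde P$, $a_i$ is the number of points of $\tilde M_T$ on the $i$-th boundary component, and $b_i=\sum_{\mathfrak b}(m-w(\mathfrak b))$, the sum being over the $\mathfrak b\in\tilde{\mathfrak B}$ on the $i$-th boundary component. -/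

import Mathlib

universe u

/-! ## Bound quivers, gentle bound quivers and the AG-invariant -/

/-- A quiver `Q` together with a set of paths of length two generating a (monomial) ideal `I`:
`rel a b` means that the path `ab` (first `a`, then `b`) is one of the generators. -/
structure BoundQuiver where
  V : Type u
  A : Type u
  s : A → V
  t : A → V
  rel : A → A → Prop
  t_eq_s_of_rel : ∀ {a b : A}, rel a b → t a = s b

namespace BoundQuiver

/-- Isomorphisms of quivers that identify the two ideals of relations. -/
structure Iso (Q R : BoundQuiver.{u}) where
  vertex : Q.V ≃ R.V
  arrow : Q.A ≃ R.A
  s_arrow : ∀ a, R.s (arrow a) = vertex (Q.s a)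
  t_arrow : ∀ a, R.t (arrow a) = vertex (Q.t a)
  rel_arrow : ∀ a b, R.rel (arrow a) (arrow b) ↔ Q.rel a b

variable (Q : BoundQuiver.{u})

/-- A non-trivial path which is not in the monomial ideal `I`. -/
def IsPermittedPath (l : List Q.A) : Prop :=
  l ≠ [] ∧ l.IsChain (fun a b => Q.t a = Q.s b ∧ ¬ Q.rel a b)

/-- A non-trivial sequence of pairwise distinct arrows, any two consecutive ones forming a
relation. -/
def IsForbiddenPath (l : List Q.A) : Prop :=
  l ≠ [] ∧ l.Nodup ∧ l.IsChain Q.rel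

/-- `kQ/I` is a gentle algebra.  Condition (G2), that `I` is generated by paths of length two, is
built into `BoundQuiver`; the last clause says that `kQ/I` is finite-dimensional. -/
structure IsGentle : Prop where
  finite_V : Finite Q.V
  finite_A : Finite Q.A
  out_le_two : ∀ x, {a | Q.s a = x}.ncard ≤ 2
  in_le_two : ∀ x, {a | Q.t a = x}.ncard ≤ 2
  rel_left : ∀ a a' b, Q.rel a b → Q.rel a' b → a = a'
  rel_right : ∀ b c c', Q.rel b c → Q.rel b c' → c = c'
  nonrel_left : ∀ a a' b, Q.t a = Q.s b → ¬ Q.rel a b → Q.t a' = Q.s b → ¬ Q.rel a' b → a = a'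
  nonrel_right : ∀ b c c', Q.t b = Q.s c → ¬ Q.rel b c → Q.t b = Q.s c' → ¬ Q.rel b c' → c = c'
  bounded : ∃ N, ∀ l, Q.IsPermittedPath l → l.length ≤ N

/-- The sign functions `σ, ε` on the arrows.  The first three conditions are the usual ones.  The
last one is automatic in a gentle bound quiver, except at a vertex whose only arrows are one
incoming `a` and one outgoing `b` with `ab ∈ I`; there it is what makes the two prescriptions
`σ(p) = ε(p) = -σ(b)` and `σ(p) = ε(p) = -ε(a)` for the trivial forbidden thread `p` agree. -/
structure IsSignPair (σ ε : Q.A → ℤˣ) : Prop where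
  source : ∀ a b, a ≠ b → Q.s a = Q.s b → σ a = -σ b
  target : ∀ a b, a ≠ b → Q.t a = Q.t b → ε a = -ε b
  nonrel : ∀ a b, Q.t a = Q.s b → ¬ Q.rel a b → σ b = -ε a
  rel : ∀ a b, Q.rel a b → σ b = ε a

/-- Candidates for threads: `path a l` is the non-trivial path with first arrow `a` followed by the
arrows in `l`; `triv x δ` is the constant path at `x` together with the value `δ` that `σ` takes
on it. -/
inductive Thread
  | triv (x : Q.V) (δ : ℤˣ)
  | path (a : Q.A) (l : List Q.A)

namespace Thread

variable {Q}

def start : Q.Thread → Q.V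
  | triv x _ => x
  | path a _ => Q.s a

def finish : Q.Thread → Q.V
  | triv x _ => x
  | path a l => Q.t ((a :: l).getLast (List.cons_ne_nil a l))

def length : Q.Thread → ℕ
  | triv _ _ => 0
  | path _ l => l.length + 1

def sigma (σ : Q.A → ℤˣ) : Q.Thread → ℤˣ
  | triv _ δ => δ
  | path a _ => σ a

/-- `ε` on permitted threads; on a trivial one it is `-σ`. -/
def epsPermitted (ε : Q.A → ℤˣ) : Q.Thread → ℤˣ
  | triv _ δ => -δ
  | path a l => ε ((a :: l).getLast (List.cons_ne_nil a l))

/-- `ε` on forbidden threads; on a trivial one it is `σ`. -/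
def epsForbidden (ε : Q.A → ℤˣ) : Q.Thread → ℤˣ
  | triv _ δ => δ
  | path a l => ε ((a :: l).getLast (List.cons_ne_nil a l))

/-- Permitted threads.  For a trivial thread `h` the last two clauses are `σ(h) = -σ(a)` if `a`
starts at `x` and `ε(h) = -ε(b)` if `b` ends at `x`.  At an isolated vertex both signs occur, so
such a vertex carries two trivial permitted threads. -/
def IsPermitted (σ ε : Q.A → ℤˣ) : Q.Thread → Prop
  | triv x δ =>
      (∀ a a', Q.s a = x → Q.s a' = x → a = a') ∧
      (∀ b b', Q.t b = x → Q.t b' = x → b = b') ∧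
      (∀ b a, Q.t b = x → Q.s a = x → ¬ Q.rel b a) ∧
      (∀ a, Q.s a = x → δ = -σ a) ∧
      (∀ b, Q.t b = x → -δ = -ε b)
  | path a l =>
      Q.IsPermittedPath (a :: l) ∧
      ∀ b, ¬ Q.IsPermittedPath (b :: a :: l) ∧ ¬ Q.IsPermittedPath (a :: l ++ [b])

/-- Forbidden threads.  For a trivial thread `p` the last two clauses are `σ(p) = -σ(a)` if `a`
starts at `x` and `ε(p) = -ε(b)` if `b` ends at `x`.  An isolated vertex carries two of them. -/
def IsForbidden (σ ε : Q.A → ℤˣ) : Q.Thread → Prop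
  | triv x δ =>
      (∀ a a', Q.s a = x → Q.s a' = x → a = a') ∧
      (∀ b b', Q.t b = x → Q.t b' = x → b = b') ∧
      (∀ b a, Q.t b = x → Q.s a = x → Q.rel b a) ∧
      (∀ a, Q.s a = x → δ = -σ a) ∧
      (∀ b, Q.t b = x → δ = -ε b)
  | path a l =>
      Q.IsForbiddenPath (a :: l) ∧
      ∀ b, ¬ Q.IsForbiddenPath (b :: a :: l) ∧ ¬ Q.IsForbiddenPath (a :: l ++ [b])

/-- One round of the algorithm: from the permitted thread `H` to the forbidden thread `F` that ends
where `H` ends, and on to the permitted thread `H'` that starts where `F` starts. -/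
structure Step (σ ε : Q.A → ℤˣ) (H F H' : Q.Thread) : Prop where
  permitted : H.IsPermitted σ ε
  forbidden : F.IsForbidden σ ε
  permitted' : H'.IsPermitted σ ε
  finish_eq : F.finish = H.finish
  eps_eq : H.epsPermitted ε = -F.epsForbidden ε
  start_eq : H'.start = F.start
  sigma_eq : F.sigma σ = -H'.sigma σ

end Thread

/-- The sets `{H₀, …, Hₙ₋₁}` of permitted threads that the algorithm runs through before it returns
to `H₀` for the first time, with total length `l` of the forbidden threads `F₀, …, Fₙ₋₁` met on
the way.  As a set, an orbit does not remember with which of its threads the algorithm began. -/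
def agOrbits (σ ε : Q.A → ℤˣ) (n l : ℕ) : Set (Set Q.Thread) :=
  {O | ∃ H F : ℕ → Q.Thread, 0 < n ∧ (∀ i < n, Thread.Step σ ε (H i) (F i) (H (i + 1))) ∧
    H n = H 0 ∧ (∀ i, 0 < i → i < n → H i ≠ H 0) ∧
    ∑ i ∈ Finset.range n, (F i).length = l ∧ O = H '' Set.Iio n}

/-- The oriented cycles of length `n` (up to rotation) in which any two consecutive arrows form a
relation. -/
def relationCycles (n : ℕ) : Set (Cycle Q.A) :=
  {c | c ≠ Cycle.nil ∧ c.Nodup ∧ c.Chain Q.rel ∧ c.length = n}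

/-- The number of times the pair `(n, l)` is produced by the AG algorithm. -/
noncomputable def ag (σ ε : Q.A → ℤˣ) (n l : ℕ) : ℕ :=
  (Q.agOrbits σ ε n l).ncard + if n = 0 then (Q.relationCycles l).ncard else 0

/-- The AG-invariant of `Q` is the function `f`: sign functions exist, and the algorithm produces
`f` whatever sign functions are chosen. -/
def HasAGInvariant (f : ℕ → ℕ → ℕ) : Prop :=
  (∃ σ ε, Q.IsSignPair σ ε) ∧ ∀ σ ε, Q.IsSignPair σ ε → ∀ n l, Q.ag σ ε n l = f n l

end BoundQuiver

/-- The function `(a, b)^*` on `ℕ × ℕ`, with value `1` at `(a, b)` and `0` elsewhere. -/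
def pairStar (a b : ℤ) (x y : ℕ) : ℕ :=
  if (x : ℤ) = a ∧ (y : ℤ) = b then 1 else 0

/-! ## Angulated surfaces -/

/-- An oriented surface with boundary that is cut into finitely many `(m+2)`-gons.  The sides of
the polygon `f` are `(f, i)`, `i : ZMod (m+2)`, in counter-clockwise order and each directed
counter-clockwise.  The side `d` is glued to the side `glue d`, reversing directions (so that the
surface is oriented), if `glue d ≠ d`, and lies on the boundary of the surface if `glue d = d`. -/
structure PolygonGluing (m : ℕ) where
  Face : Type u
  finite_face : Finite Face
  glue : Face × ZMod (m + 2) → Face × ZMod (m + 2)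
  glue_glue : ∀ d, glue (glue d) = d

namespace PolygonGluing

variable {m : ℕ} (P : PolygonGluing.{u} m)

abbrev Side : Type u := P.Face × ZMod (m + 2)

/-- The next side of the same polygon in counter-clockwise direction. -/
def succ (d : P.Side) : P.Side := (d.1, d.2 + 1)

/-- The previous side of the same polygon. -/
def pred (d : P.Side) : P.Side := (d.1, d.2 - 1)

/-- `d` is one of the two sides of an arc in the interior of the surface. -/
def IsArc (d : P.Side) : Prop := P.glue d ≠ d

abbrev ArcSide : Type u := {d : P.Side // P.IsArc d}

/-- The other side of the same arc. -/
def flip (d : P.ArcSide) : P.ArcSide :=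
  ⟨P.glue d.1, fun h => d.2 (by rw [P.glue_glue] at h; exact h.symm)⟩

/-- The set `T` of arcs: two polygon sides that are glued are the same arc. -/
def Arc : Type u := Quot (fun d d' : P.ArcSide => d' = P.flip d)

/-- The arc of which `d` is a side. -/
def arc (d : P.ArcSide) : P.Arc := Quot.mk _ d

/-- Segments of the boundary between consecutive marked points. -/
abbrev BdrySide : Type u := {d : P.Side // P.glue d = d}

/-- The set `M` of marked points.  A side `d` also stands for the corner of its polygon at which
`d` ends; gluing `d` to `glue d` identifies the end of `d` with the start of `glue d`, which is the
end of `pred (glue d)`. -/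
def Marked : Type u := Quot (fun c c' : P.Side => P.IsArc c ∧ c' = P.pred (P.glue c))

/-- The end point of a side. -/
def fin (d : P.Side) : P.Marked := Quot.mk _ d

/-- The starting point of a side. -/
def ini (d : P.Side) : P.Marked := Quot.mk _ (P.pred d)

/-- `(P, M, T)` is an `(m+2)`-angulation of an unpunctured surface: the marked points all lie on
the boundary. -/
def IsAngulation : Prop :=
  ∀ p : P.Marked, ∃ d : P.BdrySide, P.ini d.1 = p ∨ P.fin d.1 = p

/-- The set `M_T` of the marked points incident to `T`. -/
def markedT : Set P.Marked :=
  {p | ∃ d : P.ArcSide, P.ini d.1 = p ∨ P.fin d.1 = p}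

/-- The boundary components. -/
def Component : Type u := Quot (fun d d' : P.BdrySide => P.fin d.1 = P.ini d'.1)

/-- The pieces into which the points of `M_T` divide the boundary. -/
def Piece : Type u :=
  Quot (fun d d' : P.BdrySide => P.fin d.1 = P.ini d'.1 ∧ P.fin d.1 ∉ P.markedT)

/-- The set `𝔅` of those pieces of the boundary that have their end points in `M_T`. -/
def Segment : Type u :=
  {b : P.Piece // (∃ d : P.BdrySide, Quot.mk _ d = b ∧ P.ini d.1 ∈ P.markedT) ∧
    ∃ d : P.BdrySide, Quot.mk _ d = b ∧ P.fin d.1 ∈ P.markedT}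

instance : Finite P.Side := by
  have := P.finite_face
  infer_instance

instance : Finite P.Component := Quot.finite _

instance : Finite P.Segment := by
  have : Finite P.Piece := Quot.finite _
  exact Subtype.finite

variable {P}

/-- The boundary side `d` belongs to the segment `b`. -/
def Segment.HasSide (b : P.Segment) (d : P.BdrySide) : Prop := Quot.mk _ d = b.1

/-- The boundary component to which a segment belongs. -/
def Segment.component (b : P.Segment) : P.Component :=
  Quot.map id (fun _ _ h => h.1) b.1

/-- The weight `w(b) = #((M ∩ b) \ M_T)`. -/
noncomputable def Segment.weight (b : P.Segment) : ℕ :=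
  {p : P.Marked | (∃ d, b.HasSide d ∧ (P.ini d.1 = p ∨ P.fin d.1 = p)) ∧ p ∉ P.markedT}.ncard

/-- The number of points of `M_T` on the boundary component `i`. -/
noncomputable def Component.numMarkedT (i : P.Component) : ℕ :=
  {p : P.Marked | p ∈ P.markedT ∧
    ∃ d : P.BdrySide, Quot.mk _ d = i ∧ (P.ini d.1 = p ∨ P.fin d.1 = p)}.ncard

/-- The sum of `m - w(b)` over the segments `b` on the boundary component `i`. -/
noncomputable def Component.weightSum (i : P.Component) : ℤ :=
  ∑ᶠ b : {b : P.Segment // b.component = i}, ((m : ℤ) - (b.1.weight : ℤ))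

variable (P)

/-- Every polygon contains at most one element of `𝔅`. -/
def IsNondegenerate : Prop :=
  ∀ b b' : P.Segment, ∀ d d' : P.BdrySide, b.HasSide d → b'.HasSide d' → d.1.1 = d'.1.1 → b = b'

/-- The number of internal polygons, i.e. of those having only arcs as sides. -/
noncomputable def numInternal : ℕ :=
  Nat.card {f : P.Face // ∀ i, P.IsArc (f, i)}

/-- The bound quiver `(Q_T, I_T)`.  Its vertices are the arcs.  There is one arrow for each angle
of a polygon that is formed by two arcs: the angle between the side `d` and the next side `succ d`
in counter-clockwise direction gives an arrow from the arc of `d` to the arc of `succ d`.  The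
ideal is generated by the products of arrows given by neighbouring angles of the same polygon. -/
def quiver : BoundQuiver.{u} where
  V := P.Arc
  A := {d : P.Side // P.IsArc d ∧ P.IsArc (P.succ d)}
  s a := P.arc ⟨a.1, a.2.1⟩
  t a := P.arc ⟨P.succ a.1, a.2.2⟩
  rel a b := b.1 = P.succ a.1
  t_eq_s_of_rel := by
    rintro ⟨a, ha⟩ ⟨b, hb⟩ h
    simp only at h
    subst h
    rfl

/-! ### Cutting out the boundary bridges -/

/-- The maximal sequences of consecutive sides of a polygon that are composed of arcs.  A polygon
with `s > 1` boundary segments from `𝔅` has `s` of them; any other polygon with at least one arc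
among its sides has just one. -/
def Run : Type u := Quot (fun d d' : P.ArcSide => d'.1 = P.succ d.1)

instance : Finite P.Run := Quot.finite _

variable {P}

/-- The polygon in which a run of arcs lies. -/
def Run.face : P.Run → P.Face :=
  Quot.lift (fun d => d.1.1) (fun d d' h => by rw [show d'.1 = P.succ d.1 from h]; rfl)

/-- The side number `i` of the polygon of the run `ρ` is one of the arcs of `ρ`. -/
def Run.HasArc (ρ : P.Run) (i : ZMod (m + 2)) : Prop :=
  ∃ h : P.IsArc (ρ.face, i), Quot.mk _ ⟨(ρ.face, i), h⟩ = ρ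

theorem Run.hasArc_mk (d : P.ArcSide) : Run.HasArc (Quot.mk _ d : P.Run) d.1.2 :=
  ⟨d.2, rfl⟩

variable (P)

/-- The side of the cut surface that corresponds to the side `d` of an arc. -/
def cutSide (d : P.ArcSide) : P.Run × ZMod (m + 2) := (Quot.mk _ d, d.1.2)

theorem cutSide_injective : Function.Injective P.cutSide := by
  intro d d' h
  have h1 : Run.face (P.cutSide d).1 = Run.face (P.cutSide d').1 := by rw [h]
  have h2 : (P.cutSide d).2 = (P.cutSide d').2 := by rw [h]
  exact Subtype.ext (Prod.ext h1 h2)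

theorem flip_flip (d : P.ArcSide) : P.flip (P.flip d) = d :=
  Subtype.ext (P.glue_glue d.1)

open Classical in
/-- The gluing of the cut surface: the arcs are glued as before, every other side is on the
boundary. -/
noncomputable def cutGlue (x : P.Run × ZMod (m + 2)) : P.Run × ZMod (m + 2) :=
  if h : x.1.HasArc x.2 then P.cutSide (P.flip ⟨(x.1.face, x.2), h.1⟩) else x

theorem cutGlue_cutSide (d : P.ArcSide) : P.cutGlue (P.cutSide d) = P.cutSide (P.flip d) := by
  unfold cutGlue
  rw [dif_pos (show Run.HasArc (P.cutSide d).1 (P.cutSide d).2 from Run.hasArc_mk d)]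
  rfl

theorem cutGlue_cutGlue (x : P.Run × ZMod (m + 2)) : P.cutGlue (P.cutGlue x) = x := by
  by_cases h : x.1.HasArc x.2
  · have hx : x = P.cutSide ⟨(x.1.face, x.2), h.1⟩ := Prod.ext h.2.symm rfl
    rw [hx, cutGlue_cutSide, cutGlue_cutSide, flip_flip]
  · have hx : P.cutGlue x = x := dif_neg h
    rw [hx, hx]

/-- The surface obtained by cutting out all boundary bridges.  In a polygon `Δ` with `s > 1`
boundary segments, what remains after the bridge is removed is one `(m+2)`-gon for each run of
arcs of `Δ`; if the run consists of `r` arcs, then this `(m+2)`-gon has the `r` arcs as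
consecutive sides, and its `m + 2 - r` other sides (which come from the two short pieces of the old
boundary next to the run and the new curve joining them) lie on the new boundary.  Thus it is a
copy of `Δ` in which exactly the sides in the run are still glued.  A polygon that has only one run
of arcs is left as it is. -/
noncomputable def cut : PolygonGluing.{u} m where
  Face := P.Run
  finite_face := inferInstance
  glue := P.cutGlue
  glue_glue := P.cutGlue_cutGlue

/-- The identity of arcs, as a map from the sides of arcs in `P` to the sides of arcs in the cut
surface. -/
noncomputable def keep (d : P.ArcSide) : P.cut.ArcSide :=
  ⟨P.cutSide d, fun h => d.2 (congrArg Subtype.val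
    (P.cutSide_injective ((P.cutGlue_cutSide d).symm.trans h)))⟩

end PolygonGluing

/-! Everything is read off from the sides of arcs. A vertex of the quiver has two sides, exchanged
by `flip`; an arrow leads from an arc side `d` to the arc side `succ d`. A composable pair of arrows
is a relation when the second starts at the side where the first ends, and a non-relation when it
starts at the flip of that side. Hence forbidden paths run along the sides of one polygon, and
permitted paths rotate about one marked point. `Ribbon` isolates this combinatorics. The signs σ and
ε are both pulled back from one odd function on sides (`exists_signs_of_isSignPair`), so a vertex
with a sign names a side, and trivial threads become walks of length zero.

That all marked points lie on the boundary means that every rotation about a marked point stops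
(`isAngulation_iff_terminates`). This bounds permitted paths and gives gentleness. A maximal
rotation begins at the flip of an arc side preceded in its polygon by a boundary side, so permitted
threads are indexed by `Start`. It ends at an arc side `E` followed by a boundary side. The
forbidden thread ending there is the run of arcs with last side `E`, and the next permitted thread
begins at the flip of the first side of that run. Going along the boundary one instead passes from
`E` through boundary sides to the next run of the same polygon. When the polygon has a single run
the two prescriptions agree, and counting its `m + 2` sides as `ℓ + 1` arc sides and `w + 1`
boundary sides gives `ℓ = m - w` (`startPerm_eq_of_isWalk`). Orbits of the algorithm are then the
cycles of `startPerm`, which are the boundary components, while starts correspond both to the points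
of `M_T` on a component and to its segments.

Cutting turns each run into a polygon of its own and preserves the gluing and the adjacency of arc
sides, hence the bound quiver (`cutIso`), and produces a surface with at most one start per polygon.
The orbits are counted on the cut surface through `cutIso`; the relation cycles are counted on the
original one, where they are the boundaries of internal polygons (`ncard_relationCycles`). -/

/-! ## Iterating a map until a predicate holds -/

section FirstHit

variable {α : Type*} (f : α → α) (p : α → Prop)

/-- The number of times `f` has to be applied to `x` until `p` holds. -/
noncomputable def hitTime (x : α) : ℕ := sInf {k | p (f^[k] x)}

/-- The first iterate of `x` under `f` for which `p` holds. -/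
noncomputable def firstHit (x : α) : α := f^[hitTime f p x] x

variable {f p}

theorem firstHit_spec {x : α} (h : ∃ k, p (f^[k] x)) : p (firstHit f p x) :=
  Nat.sInf_mem (s := {k | p (f^[k] x)}) h

theorem not_of_lt_hitTime {x : α} {k : ℕ} (h : k < hitTime f p x) : ¬ p (f^[k] x) :=
  Nat.notMem_of_lt_sInf (s := {k | p (f^[k] x)}) h

theorem hitTime_le {x : α} {k : ℕ} (h : p (f^[k] x)) : hitTime f p x ≤ k :=
  Nat.sInf_le (s := {k | p (f^[k] x)}) h

theorem hitTime_iterate {x : α} {k : ℕ} (h : ∃ k, p (f^[k] x)) (hk : k ≤ hitTime f p x) :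
    hitTime f p (f^[k] x) = hitTime f p x - k := by
  have hx := firstHit_spec h
  have h1 : p (f^[hitTime f p x - k] (f^[k] x)) := by
    rw [← Function.iterate_add_apply, Nat.sub_add_cancel hk]; exact hx
  apply le_antisymm (hitTime_le h1)
  have h2 := firstHit_spec (f := f) (p := p) ⟨_, h1⟩
  rw [firstHit, ← Function.iterate_add_apply] at h2
  have := hitTime_le h2
  omega

theorem firstHit_iterate {x : α} {k : ℕ} (h : ∃ k, p (f^[k] x)) (hk : k ≤ hitTime f p x) :
    firstHit f p (f^[k] x) = firstHit f p x := by
  rw [firstHit, hitTime_iterate h hk, ← Function.iterate_add_apply, Nat.sub_add_cancel hk, firstHit]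

theorem hitTime_of {x : α} (h : p x) : hitTime f p x = 0 :=
  Nat.le_zero.1 (hitTime_le (k := 0) h)

theorem firstHit_of {x : α} (h : p x) : firstHit f p x = x := by
  rw [firstHit, hitTime_of h]; rfl

theorem hitTime_pos {x : α} (h : ∃ k, p (f^[k] x)) (hx : ¬ p x) : 0 < hitTime f p x := by
  rcases Nat.eq_zero_or_pos (hitTime f p x) with h0 | h0
  · have := firstHit_spec h
    rw [firstHit, h0] at this
    exact absurd this hx
  · exact h0

theorem firstHit_apply {x : α} (h : ∃ k, p (f^[k] x)) (hx : ¬ p x) :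
    firstHit f p (f x) = firstHit f p x :=
  firstHit_iterate (k := 1) h (hitTime_pos h hx)

theorem hitTime_apply {x : α} (h : ∃ k, p (f^[k] x)) (hx : ¬ p x) :
    hitTime f p (f x) + 1 = hitTime f p x := by
  have h1 := hitTime_iterate (k := 1) h (hitTime_pos h hx)
  have h2 := hitTime_pos h hx
  rw [Function.iterate_one] at h1
  omega

theorem firstHit_eq_or (x : α) :
    firstHit f p x = x ∨ ∃ z, ¬ p z ∧ f z = firstHit f p x := by
  rcases h : hitTime f p x with _ | k
  · left; rw [firstHit, h]; rfl
  · right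
    exact ⟨f^[k] x, not_of_lt_hitTime (by omega), by
      rw [firstHit, h, Function.iterate_succ_apply']⟩

theorem eq_iterate_of_firstHit_eq (hf : f.Injective) {x y : α}
    (h : firstHit f p x = firstHit f p y) (hxy : hitTime f p x ≤ hitTime f p y) :
    x = f^[hitTime f p y - hitTime f p x] y := by
  apply hf.iterate (hitTime f p x)
  rw [← Function.iterate_add_apply, Nat.add_sub_cancel' hxy]
  exact h

/-- By injectivity the shorter trajectory is a tail of the longer one. In the applications the last
two alternatives contradict what is known about `x` and `y`, so elements are recovered from their
first hits. -/
theorem eq_or_of_firstHit_eq (hf : f.Injective) {x y : α}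
    (h : firstHit f p x = firstHit f p y) :
    x = y ∨ (∃ z, ¬ p z ∧ f z = x) ∨ ∃ z, ¬ p z ∧ f z = y := by
  wlog hxy : hitTime f p x ≤ hitTime f p y generalizing x y
  · rcases this h.symm (le_of_not_ge hxy) with h | h | h
    exacts [.inl h.symm, .inr (.inr h), .inr (.inl h)]
  have h1 := eq_iterate_of_firstHit_eq hf h hxy
  rcases h2 : hitTime f p y - hitTime f p x with _ | k
  · left; rw [h1, h2]; rfl
  · right; left
    refine ⟨f^[k] y, not_of_lt_hitTime (by omega), ?_⟩
    rw [h1, h2, Function.iterate_succ_apply']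

end FirstHit

/-! ## Bound quivers of ribbon type -/

namespace BoundQuiver

/-- A description of a bound quiver by means of the set `D` of pairs consisting of a vertex and one
of its two sides.  Each arrow leads from a side of its source to a side of its target; a product of
two arrows is a relation if the second starts at the side at which the first one ends. -/
structure Ribbon (Q : BoundQuiver.{u}) (D : Type u) where
  flip : D → D
  flip_flip : ∀ d, flip (flip d) = d
  flip_ne : ∀ d, flip d ≠ d
  vert : D → Q.V
  vert_surjective : Function.Surjective vert
  vert_eq_iff : ∀ d d', vert d = vert d' ↔ d' = d ∨ d' = flip d
  src : Q.A → D
  tgt : Q.A → D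
  src_injective : Function.Injective src
  tgt_injective : Function.Injective tgt
  s_eq : ∀ a, Q.s a = vert (src a)
  t_eq : ∀ a, Q.t a = vert (tgt a)
  rel_iff : ∀ a b, Q.rel a b ↔ src b = tgt a

namespace Ribbon

/-- Transport of a ribbon description along an isomorphism of bound quivers. -/
def ofIso {Q R : BoundQuiver.{u}} {D : Type u} (r : Ribbon R D) (e : Iso Q R) : Ribbon Q D where
  flip := r.flip
  flip_flip := r.flip_flip
  flip_ne := r.flip_ne
  vert d := e.vertex.symm (r.vert d)
  vert_surjective := e.vertex.symm.surjective.comp r.vert_surjective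
  vert_eq_iff d d' := by rw [e.vertex.symm.injective.eq_iff, r.vert_eq_iff]
  src a := r.src (e.arrow a)
  tgt a := r.tgt (e.arrow a)
  src_injective := r.src_injective.comp e.arrow.injective
  tgt_injective := r.tgt_injective.comp e.arrow.injective
  s_eq a := by rw [← r.s_eq, e.s_arrow, Equiv.symm_apply_apply]
  t_eq a := by rw [← r.t_eq, e.t_arrow, Equiv.symm_apply_apply]
  rel_iff a b := by rw [← e.rel_arrow, r.rel_iff]

variable {Q : BoundQuiver.{u}} {D : Type u} (r : Ribbon Q D)

theorem flip_injective : Function.Injective r.flip :=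
  Function.LeftInverse.injective r.flip_flip

theorem flip_eq_iff {d d' : D} : r.flip d = d' ↔ d = r.flip d' :=
  ⟨fun h => by rw [← h, r.flip_flip], fun h => by rw [h, r.flip_flip]⟩

/-- The side at which an arrow has to start in order to form a non-zero path with `a`. -/
def turn (a : Q.A) : D := r.flip (r.tgt a)

theorem turn_injective : Function.Injective r.turn := r.flip_injective.comp r.tgt_injective

theorem nonrel_iff (a b : Q.A) : Q.t a = Q.s b ∧ ¬ Q.rel a b ↔ r.src b = r.turn a := by
  rw [r.rel_iff, r.t_eq, r.s_eq, r.vert_eq_iff, turn]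
  constructor
  · rintro ⟨h | h, h'⟩
    exacts [absurd h h', h]
  · intro h
    exact ⟨.inr h, fun h' => r.flip_ne _ (h.symm.trans h')⟩

/-- `l` is a sequence of arrows leading from the side `d` to the side `e`; after the arrow `a` it
continues from the side `τ a`. -/
def IsWalk (τ : Q.A → D) : D → List Q.A → D → Prop
  | d, [], e => d = e
  | d, a :: l, e => r.src a = d ∧ IsWalk τ (τ a) l e

/-! ### Walks between sides: existence, uniqueness, finiteness -/

variable {r} {τ : Q.A → D}

theorem isWalk_cons_iff (a : Q.A) (l : List Q.A) (e : D) :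
    r.IsWalk τ (r.src a) (a :: l) e ↔
      (a :: l).IsChain (fun a b => r.src b = τ a) ∧
        τ ((a :: l).getLast (List.cons_ne_nil a l)) = e := by
  induction l generalizing a with
  | nil => simp [IsWalk]
  | cons b l ih =>
    rw [List.isChain_cons_cons, List.getLast_cons (List.cons_ne_nil b l), and_assoc, ← ih b]
    constructor
    · rintro ⟨-, h, h'⟩
      exact ⟨h, rfl, h'⟩
    · rintro ⟨h, -, h'⟩
      exact ⟨rfl, h, h'⟩

theorem isWalk_append {d e : D} {l l' : List Q.A} :
    r.IsWalk τ d (l ++ l') e ↔ ∃ c, r.IsWalk τ d l c ∧ r.IsWalk τ c l' e := by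
  induction l generalizing d with
  | nil => simp [IsWalk]
  | cons a l ih => simp [IsWalk, ih, and_assoc]

/-- A walk is deterministic because `src` is injective, and it can stop for good only at a side
where no arrow starts. -/
theorem IsWalk.unique {d e e' : D} {l l' : List Q.A} (h : r.IsWalk τ d l e)
    (h' : r.IsWalk τ d l' e') (he : e ∉ Set.range r.src) (he' : e' ∉ Set.range r.src) : l = l' := by
  induction l generalizing d l' with
  | nil =>
    cases l' with
    | nil => rfl
    | cons b l' => exact absurd ⟨b, h'.1.trans h⟩ he
  | cons a l ih =>
    cases l' with
    | nil => exact absurd ⟨a, h.1.trans h'⟩ he'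
    | cons b l' =>
      obtain rfl := r.src_injective (h.1.trans h'.1.symm)
      rw [ih h.2 h'.2]

/-- If the first arrow recurred, the part of the walk after its first occurrence and the part after
its second would both lead from the same side to the same dead end, contradicting uniqueness by
length. -/
theorem IsWalk.nodup {d e : D} {l : List Q.A} (h : r.IsWalk τ d l e)
    (he : e ∉ Set.range r.src) : l.Nodup := by
  induction l generalizing d with
  | nil => exact List.nodup_nil
  | cons a l ih =>
    refine List.nodup_cons.2 ⟨fun ha => ?_, ih h.2⟩
    obtain ⟨l₁, l₂, rfl⟩ := List.append_of_mem ha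
    obtain ⟨c, -, h2⟩ := isWalk_append.1 h.2
    have := congrArg List.length (h.2.unique h2.2 he he)
    simp at this
    omega

theorem IsWalk.length_le {rank : D → ℕ} (hτ : ∀ a, rank (τ a) < rank (r.src a)) {d e : D}
    {l : List Q.A} (h : r.IsWalk τ d l e) : l.length ≤ rank d := by
  induction l generalizing d with
  | nil => exact Nat.zero_le _
  | cons a l ih =>
    have h1 := ih h.2
    have h2 := hτ a
    rw [h.1] at h2
    simp only [List.length_cons]
    omega

theorem exists_isWalk {rank : D → ℕ} (hτ : ∀ a, rank (τ a) < rank (r.src a)) (d : D) :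
    ∃ l e, r.IsWalk τ d l e ∧ e ∉ Set.range r.src := by
  induction hn : rank d using Nat.strong_induction_on generalizing d with
  | _ n ih =>
    by_cases h : d ∈ Set.range r.src
    · obtain ⟨a, rfl⟩ := h
      obtain ⟨l, e, hl, he⟩ := ih _ (hn ▸ hτ a) _ rfl
      exact ⟨a :: l, e, ⟨rfl, hl⟩, he⟩
    · exact ⟨[], d, rfl, h⟩

/-- Extend the walk backwards as long as possible. No rank function is available for forbidden
walks, which may go round an internal polygon; instead, walks into a dead end have distinct arrows,
so their length is bounded by the number of arrows. -/
theorem exists_isWalk_to [Finite D] {e : D} (he : e ∉ Set.range r.src) :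
    ∃ d l, r.IsWalk τ d l e ∧ d ∉ Set.range τ := by
  have : Finite Q.A := Finite.of_injective _ r.src_injective
  have : Fintype Q.A := Fintype.ofFinite _
  suffices ∀ n d l, r.IsWalk τ d l e → Fintype.card Q.A ≤ l.length + n →
      ∃ d l, r.IsWalk τ d l e ∧ d ∉ Set.range τ from this _ e [] rfl (Nat.le_add_left _ _)
  intro n
  induction n with
  | zero =>
    intro d l hl hn
    refine ⟨d, l, hl, ?_⟩
    rintro ⟨b, rfl⟩
    have h := (show r.IsWalk τ (r.src b) (b :: l) e from ⟨rfl, hl⟩).nodup he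
    have := h.length_le_card
    simp at this
    omega
  | succ n ih =>
    intro d l hl hn
    by_cases hd : d ∈ Set.range τ
    · obtain ⟨b, rfl⟩ := hd
      exact ih (r.src b) (b :: l) ⟨rfl, hl⟩ (by simp; omega)
    · exact ⟨d, l, hl, hd⟩

theorem isPermittedPath_iff {a : Q.A} {l : List Q.A} :
    Q.IsPermittedPath (a :: l) ↔ ∃ e, r.IsWalk r.turn (r.src a) (a :: l) e := by
  simp only [isWalk_cons_iff, IsPermittedPath, r.nonrel_iff]
  simp

theorem isForbiddenPath_iff {a : Q.A} {l : List Q.A} :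
    Q.IsForbiddenPath (a :: l) ↔
      (a :: l).Nodup ∧ ∃ e, r.IsWalk r.tgt (r.src a) (a :: l) e := by
  have h : Q.rel = fun a b => r.src b = r.tgt a := funext₂ fun a b => propext (r.rel_iff a b)
  simp [isWalk_cons_iff, IsForbiddenPath, h]

/-! ### Gentleness -/

theorem ncard_le_two (r : Ribbon Q D) {g : Q.A → D} (hg : g.Injective) (x : Q.V) :
    {a | r.vert (g a) = x}.ncard ≤ 2 := by
  obtain ⟨d, rfl⟩ := r.vert_surjective x
  have h : g '' {a | r.vert (g a) = r.vert d} ⊆ {d, r.flip d} := by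
    rintro _ ⟨a, ha, rfl⟩
    rcases (r.vert_eq_iff _ _).1 ha with h | h
    · simp [← h]
    · simp [h, r.flip_flip]
  rw [← Set.ncard_image_of_injective _ hg]
  exact (Set.ncard_le_ncard h).trans (Set.ncard_pair (r.flip_ne d).symm).le

/-- The local conditions are the injectivity of `src` and `tgt` and the two-element fibres of
`vert`. A rank that drops along `turn` bounds the permitted paths. -/
theorem isGentle [Finite D] (r : Ribbon Q D) {rank : D → ℕ}
    (hrank : ∀ a, rank (r.turn a) < rank (r.src a)) : Q.IsGentle where
  finite_V := Finite.of_surjective _ r.vert_surjective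
  finite_A := Finite.of_injective _ r.src_injective
  out_le_two x := by simp only [r.s_eq]; exact r.ncard_le_two r.src_injective x
  in_le_two x := by simp only [r.t_eq]; exact r.ncard_le_two r.tgt_injective x
  rel_left a a' b h h' := by
    rw [r.rel_iff] at h h'
    exact r.tgt_injective (h.symm.trans h')
  rel_right a b b' h h' := by
    rw [r.rel_iff] at h h'
    exact r.src_injective (h.trans h'.symm)
  nonrel_left a a' b h1 h2 h3 h4 :=
    r.turn_injective (((r.nonrel_iff a b).1 ⟨h1, h2⟩).symm.trans ((r.nonrel_iff a' b).1 ⟨h3, h4⟩))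
  nonrel_right a b b' h1 h2 h3 h4 :=
    r.src_injective (((r.nonrel_iff a b).1 ⟨h1, h2⟩).trans ((r.nonrel_iff a b').1 ⟨h3, h4⟩).symm)
  bounded := by
    obtain ⟨N, hN⟩ := (Set.finite_range rank).bddAbove
    refine ⟨N, fun l hl => ?_⟩
    cases l with
    | nil => exact absurd rfl hl.1
    | cons a l =>
      obtain ⟨e, he⟩ := (isPermittedPath_iff (r := r)).1 hl
      exact (he.length_le hrank).trans (hN ⟨_, rfl⟩)

/-! ### Signs -/

theorem exists_signs (r : Ribbon Q D) : ∃ s : D → ℤˣ, ∀ d, s (r.flip d) = -s d := by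
  classical
  obtain ⟨g, hg⟩ := r.vert_surjective.hasRightInverse
  refine ⟨fun d => if g (r.vert d) = d then 1 else -1, fun d => ?_⟩
  have h1 : r.vert (r.flip d) = r.vert d := (r.vert_eq_iff _ _).2 (.inr (r.flip_flip d).symm)
  have h2 : g (r.vert d) = d ∨ g (r.vert d) = r.flip d :=
    (r.vert_eq_iff _ _).1 (hg (r.vert d)).symm
  rcases h2 with h | h
  · simp only [h1, h, if_neg (r.flip_ne d).symm, if_true]
  · simp only [h1, h, if_neg (r.flip_ne d), if_true, neg_neg]

theorem isSignPair (r : Ribbon Q D) {s : D → ℤˣ} (hs : ∀ d, s (r.flip d) = -s d) :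
    Q.IsSignPair (s ∘ r.src) (s ∘ r.tgt) where
  source a b hab h := by
    rw [r.s_eq, r.s_eq, r.vert_eq_iff] at h
    rcases h with h | h
    · exact absurd (r.src_injective h).symm hab
    · simp [h, hs]
  target a b hab h := by
    rw [r.t_eq, r.t_eq, r.vert_eq_iff] at h
    rcases h with h | h
    · exact absurd (r.tgt_injective h).symm hab
    · simp [h, hs]
  nonrel a b h h' := by
    have := (r.nonrel_iff a b).1 ⟨h, h'⟩
    simp [this, turn, hs]
  rel a b h := by
    have := (r.rel_iff a b).1 h
    simp [this]

variable {σ ε : Q.A → ℤˣ}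

/-- The four rules for a sign pair say exactly that all arrow ends at `d` share one sign and all
those at `flip d` have the opposite one. The value is arbitrary only at an isolated vertex. -/
theorem exists_sign (r : Ribbon Q D) (h : Q.IsSignPair σ ε) (d : D) : ∃ z : ℤˣ,
    (∀ a, r.src a = d → σ a = z) ∧ (∀ a, r.tgt a = d → ε a = z) ∧
    (∀ a, r.src a = r.flip d → σ a = -z) ∧ ∀ a, r.tgt a = r.flip d → ε a = -z := by
  have hss : ∀ a b, r.src b = r.flip (r.src a) → σ a = -σ b := fun a b hb => by
    refine h.source a b ?_ ?_
    · rintro rfl; exact r.flip_ne _ hb.symm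
    · rw [r.s_eq, r.s_eq, r.vert_eq_iff]; exact .inr hb
  have htt : ∀ a b, r.tgt b = r.flip (r.tgt a) → ε a = -ε b := fun a b hb => by
    refine h.target a b ?_ ?_
    · rintro rfl; exact r.flip_ne _ hb.symm
    · rw [r.t_eq, r.t_eq, r.vert_eq_iff]; exact .inr hb
  have hts : ∀ a b, r.src b = r.flip (r.tgt a) → σ b = -ε a := fun a b hb => by
    have := (r.nonrel_iff a b).2 hb
    exact h.nonrel a b this.1 this.2
  have hr : ∀ a b, r.src b = r.tgt a → σ b = ε a := fun a b hb => h.rel a b ((r.rel_iff a b).2 hb)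
  have key : ∀ d, ((∃ a, r.src a = d) ∨ ∃ a, r.tgt a = d) → ∃ z : ℤˣ,
      (∀ a, r.src a = d → σ a = z) ∧ (∀ a, r.tgt a = d → ε a = z) ∧
      (∀ a, r.src a = r.flip d → σ a = -z) ∧ ∀ a, r.tgt a = r.flip d → ε a = -z := by
    rintro d (⟨a, rfl⟩ | ⟨a, rfl⟩)
    · refine ⟨σ a, fun b hb => ?_, fun b hb => ?_, fun b hb => ?_, fun b hb => ?_⟩
      · rw [r.src_injective hb]
      · exact (hr _ _ hb.symm).symm
      · rw [hss a b hb, neg_neg]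
      · rw [hts b a (by rw [hb, r.flip_flip]), neg_neg]
    · refine ⟨ε a, fun b hb => ?_, fun b hb => ?_, fun b hb => ?_, fun b hb => ?_⟩
      · exact hr _ _ hb
      · rw [r.tgt_injective hb]
      · exact hts _ _ hb
      · rw [htt a b hb, neg_neg]
  by_cases h1 : (∃ a, r.src a = d) ∨ ∃ a, r.tgt a = d
  · exact key d h1
  by_cases h2 : (∃ a, r.src a = r.flip d) ∨ ∃ a, r.tgt a = r.flip d
  · obtain ⟨z, h3, h4, h5, h6⟩ := key _ h2
    rw [r.flip_flip] at h5 h6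
    exact ⟨-z, h5, h6, by simpa using h3, by simpa using h4⟩
  · push Not at h1 h2
    exact ⟨1, fun a ha => absurd ha (h1.1 a), fun a ha => absurd ha (h1.2 a),
      fun a ha => absurd ha (h2.1 a), fun a ha => absurd ha (h2.2 a)⟩

theorem exists_signs_of_isSignPair (r : Ribbon Q D) (h : Q.IsSignPair σ ε) :
    ∃ s : D → ℤˣ, (∀ d, s (r.flip d) = -s d) ∧ σ = s ∘ r.src ∧ ε = s ∘ r.tgt := by
  obtain ⟨o, ho⟩ := r.exists_signs
  choose z hz using r.exists_sign h
  -- The values `z d` and `z (flip d)` were chosen independently and need not be opposite at an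
  -- isolated vertex; the orientation `o` selects one side per vertex whose choice decides for both.
  refine ⟨fun d => if o d = 1 then z d else -z (r.flip d), fun d => ?_, ?_, ?_⟩
  · rcases Int.units_eq_one_or (o d) with h | h <;> simp [ho, h, r.flip_flip]
  · funext a
    rcases Int.units_eq_one_or (o (r.src a)) with h | h
    · simp [h, (hz (r.src a)).1 a rfl]
    · simp [h, (hz (r.flip (r.src a))).2.2.1 a (r.flip_flip _).symm]
  · funext a
    rcases Int.units_eq_one_or (o (r.tgt a)) with h | h
    · simp [h, (hz (r.tgt a)).2.1 a rfl]
    · simp [h, (hz (r.flip (r.tgt a))).2.2.2 a (r.flip_flip _).symm]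

end Ribbon

end BoundQuiver

namespace BoundQuiver

namespace Ribbon

variable {Q : BoundQuiver.{u}} {D : Type u} {r : Ribbon Q D} {s : D → ℤˣ}

/-! ### Threads -/

variable (r s) in
/-- The thread candidate starting at the side `d` with the arrows in `l`. -/
def thread (d : D) : List Q.A → Q.Thread
  | [] => .triv (r.vert d) (s d)
  | a :: l => .path a l

/-- A vertex together with a sign determines a side; this converts the start and end conditions of
`Thread.Step` into equalities of sides. -/
theorem eq_of_vert_eq (hs : ∀ d, s (r.flip d) = -s d) {d d' : D} (h : r.vert d = r.vert d')
    (h' : s d = s d') : d = d' := by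
  rcases (r.vert_eq_iff _ _).1 h with rfl | rfl
  · rfl
  · rw [hs] at h'
    exact absurd h' (units_ne_neg_self _)

theorem exists_vert_eq (hs : ∀ d, s (r.flip d) = -s d) (x : Q.V) (δ : ℤˣ) :
    ∃ d, r.vert d = x ∧ s d = δ := by
  obtain ⟨d, rfl⟩ := r.vert_surjective x
  by_cases h : s d = δ
  · exact ⟨d, rfl, h⟩
  · refine ⟨r.flip d, (r.vert_eq_iff _ _).2 (.inr (r.flip_flip d).symm), ?_⟩
    rw [hs, Int.units_ne_iff_eq_neg.1 h, neg_neg]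

theorem thread_length {d : D} {l : List Q.A} :
    (r.thread s d l).length = l.length := by
  cases l <;> rfl

theorem IsWalk.thread_start {τ : Q.A → D} {d e : D} {l : List Q.A} (h : r.IsWalk τ d l e) :
    (r.thread s d l).start = r.vert d := by
  cases l with
  | nil => rfl
  | cons a l => exact (r.s_eq a).trans (congrArg _ h.1)

theorem IsWalk.thread_sigma {τ : Q.A → D} {d e : D} {l : List Q.A} (h : r.IsWalk τ d l e) :
    (r.thread s d l).sigma (s ∘ r.src) = s d := by
  cases l with
  | nil => rfl
  | cons a l => exact congrArg s h.1

theorem IsWalk.last_eq {τ : Q.A → D} {a : Q.A} {l : List Q.A} {d e : D}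
    (h : r.IsWalk τ d (a :: l) e) : τ ((a :: l).getLast (List.cons_ne_nil a l)) = e := by
  obtain rfl := h.1
  exact ((isWalk_cons_iff a l e).1 h).2

theorem IsWalk.thread_finish {d e : D} {l : List Q.A} (h : r.IsWalk r.tgt d l e) :
    (r.thread s d l).finish = r.vert e := by
  cases l with
  | nil => exact congrArg _ h
  | cons a l => exact (r.t_eq _).trans (congrArg _ h.last_eq)

theorem IsWalk.thread_finish_turn {d e : D} {l : List Q.A} (h : r.IsWalk r.turn d l e) :
    (r.thread s d l).finish = r.vert e := by
  cases l with
  | nil => exact congrArg _ h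
  | cons a l => exact (r.t_eq _).trans ((r.vert_eq_iff _ _).2 (.inr h.last_eq.symm))

theorem IsWalk.thread_epsForbidden {d e : D} {l : List Q.A} (h : r.IsWalk r.tgt d l e) :
    (r.thread s d l).epsForbidden (s ∘ r.tgt) = s e := by
  cases l with
  | nil => exact congrArg s h
  | cons a l => exact congrArg s h.last_eq

theorem IsWalk.thread_epsPermitted (hs : ∀ d, s (r.flip d) = -s d) {d e : D} {l : List Q.A}
    (h : r.IsWalk r.turn d l e) : (r.thread s d l).epsPermitted (s ∘ r.tgt) = -s e := by
  cases l with
  | nil => exact congrArg (fun x => -s x) h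
  | cons a l =>
    have := h.last_eq
    rw [turn, r.flip_eq_iff] at this
    rw [← hs]
    exact congrArg s this

theorem isPermitted_triv_iff (hs : ∀ d, s (r.flip d) = -s d) (d : D) :
    (Thread.triv (r.vert d) (s d) : Q.Thread).IsPermitted (s ∘ r.src) (s ∘ r.tgt) ↔
      d ∉ Set.range r.src ∧ d ∉ Set.range r.turn := by
  simp only [Thread.IsPermitted, r.s_eq, r.t_eq, r.rel_iff, Function.comp]
  constructor
  · rintro ⟨-, -, -, h4, h5⟩
    constructor
    · rintro ⟨a, rfl⟩
      exact units_ne_neg_self _ (h4 a rfl)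
    · rintro ⟨a, rfl⟩
      have := h5 a ((r.vert_eq_iff _ _).2 (.inr rfl))
      rw [turn, hs, neg_neg] at this
      exact units_ne_neg_self _ this
  · rintro ⟨h1, h2⟩
    have hsrc : ∀ a, r.vert (r.src a) = r.vert d → r.src a = r.flip d := fun a ha => by
      rcases (r.vert_eq_iff _ _).1 ha with h | h
      · exact absurd ⟨a, h.symm⟩ h1
      · rw [h, r.flip_flip]
    have htgt : ∀ a, r.vert (r.tgt a) = r.vert d → r.tgt a = d := fun a ha => by
      rcases (r.vert_eq_iff _ _).1 ha with h | h
      · exact h.symm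
      · exact absurd ⟨a, h.symm⟩ h2
    refine ⟨fun a a' h h' => r.src_injective ((hsrc a h).trans (hsrc a' h').symm),
      fun a a' h h' => r.tgt_injective ((htgt a h).trans (htgt a' h').symm),
      fun b a h h' e => ?_, fun a h => ?_, fun b h => ?_⟩
    · rw [hsrc a h', htgt b h] at e
      exact r.flip_ne d e
    · rw [hsrc a h, hs, neg_neg]
    · rw [htgt b h]

theorem isForbidden_triv_iff (hs : ∀ d, s (r.flip d) = -s d) (d : D) :
    (Thread.triv (r.vert d) (s d) : Q.Thread).IsForbidden (s ∘ r.src) (s ∘ r.tgt) ↔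
      d ∉ Set.range r.src ∧ d ∉ Set.range r.tgt := by
  simp only [Thread.IsForbidden, r.s_eq, r.t_eq, r.rel_iff, Function.comp]
  constructor
  · rintro ⟨-, -, -, h4, h5⟩
    constructor
    · rintro ⟨a, rfl⟩
      exact units_ne_neg_self _ (h4 a rfl)
    · rintro ⟨a, rfl⟩
      exact units_ne_neg_self _ (h5 a rfl)
  · rintro ⟨h1, h2⟩
    have key : ∀ g : Q.A → D, d ∉ Set.range g → ∀ a, r.vert (g a) = r.vert d →
        g a = r.flip d := fun g hg a ha => by
      rcases (r.vert_eq_iff _ _).1 ha with h | h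
      · exact absurd ⟨a, h.symm⟩ hg
      · rw [h, r.flip_flip]
    have hsrc := key _ h1
    have htgt := key _ h2
    refine ⟨fun a a' h h' => r.src_injective ((hsrc a h).trans (hsrc a' h').symm),
      fun a a' h h' => r.tgt_injective ((htgt a h).trans (htgt a' h').symm),
      fun b a h h' => ?_, fun a h => ?_, fun b h => ?_⟩
    · rw [hsrc a h', htgt b h]
    · rw [hsrc a h, hs, neg_neg]
    · rw [htgt b h, hs, neg_neg]

theorem isPermitted_path_iff {σ ε : Q.A → ℤˣ} {a : Q.A} {l : List Q.A} {d e : D}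
    (h : r.IsWalk r.turn d (a :: l) e) :
    (Thread.path a l : Q.Thread).IsPermitted σ ε ↔
      d ∉ Set.range r.turn ∧ e ∉ Set.range r.src := by
  obtain rfl := h.1
  have hcons : ∀ b, Q.IsPermittedPath (b :: a :: l) ↔ r.turn b = r.src a := fun b => by
    rw [isPermittedPath_iff (r := r)]
    exact ⟨fun ⟨_, h'⟩ => h'.2.1.symm, fun h' => ⟨e, rfl, h' ▸ h⟩⟩
  have hsnoc : ∀ b, Q.IsPermittedPath (a :: l ++ [b]) ↔ r.src b = e := fun b => by
    rw [List.cons_append, isPermittedPath_iff (r := r), ← List.cons_append]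
    constructor
    · rintro ⟨c, hc⟩
      obtain ⟨c', h1, h2⟩ := isWalk_append.1 hc
      rw [h2.1, ← h1.last_eq, h.last_eq]
    · intro h'
      exact ⟨r.turn b, isWalk_append.2 ⟨e, h, h', rfl⟩⟩
  simp only [Thread.IsPermitted, hcons, hsnoc, Set.mem_range, not_exists, ← forall_and]
  exact and_iff_right ((isPermittedPath_iff (r := r)).2 ⟨e, h⟩)

/-- The hypothesis on `e` makes distinctness of arrows automatic. It excludes a full turn around an
internal polygon, which is a maximal sequence of distinct arrows but is never met by the algorithm,
since permitted threads finish at dead ends. -/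
theorem isForbidden_path_iff {σ ε : Q.A → ℤˣ} {a : Q.A} {l : List Q.A} {d e : D}
    (h : r.IsWalk r.tgt d (a :: l) e) (he : e ∉ Set.range r.src) :
    (Thread.path a l : Q.Thread).IsForbidden σ ε ↔ d ∉ Set.range r.tgt := by
  obtain rfl := h.1
  have hcons : ∀ b, Q.IsForbiddenPath (b :: a :: l) ↔ r.tgt b = r.src a := fun b => by
    rw [isForbiddenPath_iff (r := r)]
    constructor
    · exact fun ⟨_, _, h'⟩ => h'.2.1.symm
    · intro h'
      have h2 : r.IsWalk r.tgt (r.src b) (b :: a :: l) e := ⟨rfl, h' ▸ h⟩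
      exact ⟨h2.nodup he, e, h2⟩
  have hsnoc : ∀ b, ¬ Q.IsForbiddenPath (a :: l ++ [b]) := fun b => by
    rw [List.cons_append, isForbiddenPath_iff (r := r), ← List.cons_append]
    rintro ⟨-, c, hc⟩
    obtain ⟨c', h1, h2⟩ := isWalk_append.1 hc
    exact he ⟨b, by rw [h2.1, ← h1.last_eq, h.last_eq]⟩
  simp only [Thread.IsForbidden, hcons, hsnoc, Set.mem_range, not_exists, not_false_eq_true,
    and_true]
  exact and_iff_right ((isForbiddenPath_iff (r := r)).2 ⟨h.nodup he, e, h⟩)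

theorem IsWalk.isPermitted_thread_iff (hs : ∀ d, s (r.flip d) = -s d) {d e : D} {l : List Q.A}
    (h : r.IsWalk r.turn d l e) :
    (r.thread s d l).IsPermitted (s ∘ r.src) (s ∘ r.tgt) ↔
      d ∉ Set.range r.turn ∧ e ∉ Set.range r.src := by
  cases l with
  | nil =>
    obtain rfl : d = e := h
    exact (isPermitted_triv_iff hs d).trans and_comm
  | cons a l => exact isPermitted_path_iff h

theorem IsWalk.isForbidden_thread_iff (hs : ∀ d, s (r.flip d) = -s d) {d e : D} {l : List Q.A}
    (h : r.IsWalk r.tgt d l e) (he : e ∉ Set.range r.src) :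
    (r.thread s d l).IsForbidden (s ∘ r.src) (s ∘ r.tgt) ↔ d ∉ Set.range r.tgt := by
  cases l with
  | nil =>
    obtain rfl : d = e := h
    exact (isForbidden_triv_iff hs d).trans (and_iff_right he)
  | cons a l => exact isForbidden_path_iff h he

theorem exists_thread_of_isPermitted (hs : ∀ d, s (r.flip d) = -s d) {H : Q.Thread}
    (h : H.IsPermitted (s ∘ r.src) (s ∘ r.tgt)) :
    ∃ d l e, H = r.thread s d l ∧ r.IsWalk r.turn d l e ∧
      d ∉ Set.range r.turn ∧ e ∉ Set.range r.src := by
  cases H with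
  | triv x δ =>
    obtain ⟨d, rfl, rfl⟩ := r.exists_vert_eq hs x δ
    exact ⟨d, [], d, rfl, rfl, ((isPermitted_triv_iff hs d).1 h).symm⟩
  | path a l =>
    obtain ⟨e, he⟩ := (isPermittedPath_iff (r := r)).1 h.1
    exact ⟨_, a :: l, e, rfl, he, (isPermitted_path_iff he).1 h⟩

theorem exists_thread_of_isForbidden (hs : ∀ d, s (r.flip d) = -s d) {F : Q.Thread}
    (h : F.IsForbidden (s ∘ r.src) (s ∘ r.tgt)) :
    ∃ d l e, F = r.thread s d l ∧ r.IsWalk r.tgt d l e ∧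
      (e ∉ Set.range r.src → d ∉ Set.range r.tgt) := by
  cases F with
  | triv x δ =>
    obtain ⟨d, rfl, rfl⟩ := r.exists_vert_eq hs x δ
    exact ⟨d, [], d, rfl, rfl, fun _ => ((isForbidden_triv_iff hs d).1 h).2⟩
  | path a l =>
    obtain ⟨-, e, he⟩ := (isForbiddenPath_iff (r := r)).1 h.1
    exact ⟨_, a :: l, e, rfl, he, fun h' => (isForbidden_path_iff he h').1 h⟩

/-- One step of the algorithm on sides: go back from the end `e` along a forbidden walk to its first
side `d'`, then flip and rotate until no arrow is left. The sign conditions only select the correct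
side of the vertices. -/
theorem step_thread_iff (hs : ∀ d, s (r.flip d) = -s d) {d e : D} {l : List Q.A}
    (h : r.IsWalk r.turn d l e) (hd : d ∉ Set.range r.turn) (he : e ∉ Set.range r.src)
    {F H' : Q.Thread} :
    Thread.Step (s ∘ r.src) (s ∘ r.tgt) (r.thread s d l) F H' ↔
      ∃ d' l' l'' e'', r.IsWalk r.tgt d' l' e ∧ d' ∉ Set.range r.tgt ∧ F = r.thread s d' l' ∧
        r.IsWalk r.turn (r.flip d') l'' e'' ∧ e'' ∉ Set.range r.src ∧
        H' = r.thread s (r.flip d') l'' := by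
  constructor
  · rintro ⟨-, h2, h3, h4, h5, h6, h7⟩
    obtain ⟨d', l', e', rfl, hF, hF'⟩ := exists_thread_of_isForbidden hs h2
    obtain ⟨c, l'', e'', rfl, hH, hc, he''⟩ := exists_thread_of_isPermitted hs h3
    rw [hF.thread_finish, h.thread_finish_turn] at h4
    rw [hF.thread_epsForbidden, h.thread_epsPermitted hs, neg_inj] at h5
    rw [hF.thread_start, hH.thread_start] at h6
    rw [hF.thread_sigma, hH.thread_sigma] at h7
    obtain rfl := eq_of_vert_eq hs h4 h5.symm
    obtain rfl : c = r.flip d' := by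
      refine eq_of_vert_eq hs (h6.trans ((r.vert_eq_iff _ _).2 (.inr rfl))) ?_
      rw [hs, h7, neg_neg]
    exact ⟨d', l', l'', e'', hF, hF' he, rfl, hH, he'', rfl⟩
  · rintro ⟨d', l', l'', e'', hF, hd', rfl, hH, he'', rfl⟩
    refine ⟨(h.isPermitted_thread_iff hs).2 ⟨hd, he⟩, (hF.isForbidden_thread_iff hs he).2 hd',
      (hH.isPermitted_thread_iff hs).2 ⟨?_, he''⟩, ?_, ?_, ?_, ?_⟩
    · rintro ⟨a, ha⟩
      exact hd' ⟨a, r.flip_injective ha⟩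
    · rw [hF.thread_finish, h.thread_finish_turn]
    · rw [hF.thread_epsForbidden, h.thread_epsPermitted hs]
    · rw [hF.thread_start, hH.thread_start]
      exact (r.vert_eq_iff _ _).2 (.inr (r.flip_flip _).symm)
    · rw [hF.thread_sigma, hH.thread_sigma, hs, neg_neg]

end Ribbon

/-! ### Counting the orbits of the AG algorithm -/

section Count

variable {X C : Type*} [Finite X] {π : Equiv.Perm X} {comp : X → C}

theorem bijOn_iterate_fiber (hcomp : ∀ x y, comp x = comp y ↔ π.SameCycle x y) (x : X) :
    Set.BijOn (fun i => π^[i] x) (Set.Iio (Function.minimalPeriod π x)) {y | comp y = comp x} := by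
  have hx : x ∈ Function.periodicPts π := π.injective.mem_periodicPts x
  refine ⟨fun i _ => ?_, fun i hi j hj h => ?_, fun y hy => ?_⟩
  · refine ((hcomp _ _).2 ⟨i, ?_⟩).symm
    rw [zpow_natCast, Equiv.Perm.coe_pow]
  · exact (Function.iterate_eq_iterate_iff_of_lt_minimalPeriod hi hj).1 h
  · obtain ⟨i, hi⟩ := ((hcomp x y).1 (Eq.symm hy)).exists_pow_eq'
    refine ⟨i % Function.minimalPeriod π x,
      Nat.mod_lt _ (Function.minimalPeriod_pos_of_mem_periodicPts hx), ?_⟩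
    rw [← hi.2, Equiv.Perm.coe_pow]
    exact Function.iterate_mod_minimalPeriod_eq

/-- If `th` indexes the permitted threads by `X` and the algorithm acts as the permutation `π`, its
orbits are the images of the cycles of `π`, labelled by `comp`. The first return to the initial
thread occurs after the minimal period. -/
theorem ncard_agOrbits {Q : BoundQuiver.{u}} {σ ε : Q.A → ℤˣ} {th : X → Q.Thread}
    (hinj : th.Injective) (hperm : ∀ H, H.IsPermitted σ ε → ∃ x, th x = H) {ℓ : X → ℕ}
    (hstep : ∀ x F H', Thread.Step σ ε (th x) F H' → H' = th (π x) ∧ F.length = ℓ x)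
    (hex : ∀ x, ∃ F, Thread.Step σ ε (th x) F (th (π x)))
    (hsurj : comp.Surjective) (hcomp : ∀ x y, comp x = comp y ↔ π.SameCycle x y) (n l : ℕ) :
    (Q.agOrbits σ ε n l).ncard =
      {c | {x | comp x = c}.ncard = n ∧ ∑ᶠ x ∈ {x | comp x = c}, ℓ x = l}.ncard := by
  have hcard : ∀ x, {y | comp y = comp x}.ncard = Function.minimalPeriod π x := fun x => by
    have hb := bijOn_iterate_fiber hcomp x
    rw [← hb.image_eq, hb.injOn.ncard_image, ← Finset.coe_range,
      Set.ncard_coe_finset, Finset.card_range]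
  have hsum : ∀ x, ∑ᶠ y ∈ {y | comp y = comp x}, ℓ y =
      ∑ i ∈ Finset.range (Function.minimalPeriod π x), ℓ (π^[i] x) := fun x => by
    rw [← finsum_mem_eq_of_bijOn _ (bijOn_iterate_fiber hcomp x) (fun i _ => rfl),
      ← Finset.coe_range, finsum_mem_coe_finset]
  have himg : Q.agOrbits σ ε n l = (fun c => th '' {x | comp x = c}) ''
      {c | {x | comp x = c}.ncard = n ∧ ∑ᶠ x ∈ {x | comp x = c}, ℓ x = l} := by
    ext O
    constructor
    · rintro ⟨H, F, hn, hS, hper, hfirst, hlen, rfl⟩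
      obtain ⟨x, hx⟩ := hperm _ (hS 0 hn).permitted
      have hH : ∀ i ≤ n, H i = th (π^[i] x) := by
        intro i hi
        induction i with
        | zero => exact hx.symm
        | succ i ih =>
          have := hS i hi
          rw [ih (by omega)] at this
          rw [(hstep _ _ _ this).1, Function.iterate_succ_apply']
      have hF : ∀ i < n, (F i).length = ℓ (π^[i] x) := by
        intro i hi
        have := hS i hi
        rw [hH i hi.le] at this
        exact (hstep _ _ _ this).2
      have hmin : Function.minimalPeriod π x = n := by
        apply le_antisymm
        · apply Function.IsPeriodicPt.minimalPeriod_le hn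
          rw [hH n le_rfl, ← hx] at hper
          exact hinj hper
        · by_contra! hlt
          have hpos := Function.minimalPeriod_pos_of_mem_periodicPts
            (π.injective.mem_periodicPts x)
          apply hfirst _ hpos hlt
          rw [hH _ hlt.le, ← hx, Function.iterate_minimalPeriod]
      refine ⟨comp x, ⟨by rw [hcard, hmin], ?_⟩, ?_⟩
      · rw [hsum, hmin, ← hlen]
        exact Finset.sum_congr rfl fun i hi => (hF i (Finset.mem_range.1 hi)).symm
      · beta_reduce
        rw [← (bijOn_iterate_fiber hcomp x).image_eq, hmin, Set.image_image]
        exact Set.image_congr fun i hi => (hH i (le_of_lt hi)).symm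
    · rintro ⟨c, ⟨hc1, hc2⟩, rfl⟩
      obtain ⟨x, rfl⟩ := hsurj c
      rw [hcard] at hc1
      rw [hsum, hc1] at hc2
      choose F hF using hex
      refine ⟨fun i => th (π^[i] x), fun i => F (π^[i] x), ?_, fun i _ => ?_, ?_, ?_, ?_, ?_⟩
      · rw [← hc1]
        exact Function.minimalPeriod_pos_of_mem_periodicPts (π.injective.mem_periodicPts x)
      · simp only [Function.iterate_succ_apply']
        exact hF _
      · simp only [← hc1, Function.iterate_minimalPeriod, Function.iterate_zero, id]
      · intro i hi hin h
        have := Function.IsPeriodicPt.minimalPeriod_le hi (f := π) (x := x) (hinj h)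
        omega
      · rw [← hc2]
        exact Finset.sum_congr rfl fun i _ => (hstep _ _ _ (hF _)).2
      · simp only
        rw [← (bijOn_iterate_fiber hcomp x).image_eq, hc1, Set.image_image]
  rw [himg, Set.ncard_image_of_injective]
  intro c c' h
  obtain ⟨x, rfl⟩ := hsurj c
  have : th x ∈ th '' {y | comp y = c'} := by
    exact Set.ext_iff.1 h (th x) |>.1 ⟨x, rfl, rfl⟩
  obtain ⟨y, hy, hyx⟩ := this
  rw [← hinj hyx]
  exact hy

end Count

end BoundQuiver

namespace PolygonGluing

variable {m : ℕ} (P : PolygonGluing.{u} m)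

/-! ## The boundary of an angulated surface -/

@[simp] theorem succ_pred (d : P.Side) : P.succ (P.pred d) = d := by
  simp [succ, pred]

@[simp] theorem pred_succ (d : P.Side) : P.pred (P.succ d) = d := by
  simp [succ, pred]

theorem succ_injective : Function.Injective P.succ :=
  Function.LeftInverse.injective P.pred_succ

theorem succ_iterate (k : ℕ) (d : P.Side) : P.succ^[k] d = (d.1, d.2 + k) := by
  induction k with
  | zero => simp
  | succ k ih => rw [Function.iterate_succ_apply', ih]; simp [succ, add_assoc]

theorem exists_succ_iterate_eq {d d' : P.Side} (h : d.1 = d'.1) :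
    ∃ k < m + 2, P.succ^[k] d = d' := by
  refine ⟨(d'.2 - d.2).val, ZMod.val_lt _, ?_⟩
  rw [succ_iterate, ZMod.natCast_val, ZMod.cast_id]
  exact Prod.ext h (by simp)

theorem glue_injective : Function.Injective P.glue :=
  Function.LeftInverse.injective P.glue_glue

theorem isArc_glue {d : P.Side} : P.IsArc (P.glue d) ↔ P.IsArc d := by
  rw [IsArc, IsArc, P.glue_glue]
  exact ne_comm

/-! ### Rotation about a marked point -/

/-- From a corner of a polygon to the next corner at the same marked point. -/
def turn (c : P.Side) : P.Side := P.glue (P.succ c)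

theorem turn_injective : Function.Injective P.turn := P.glue_injective.comp P.succ_injective

theorem isArc_turn {c : P.Side} : P.IsArc (P.turn c) ↔ P.IsArc (P.succ c) := P.isArc_glue

theorem turn_pred_glue {c : P.Side} : P.turn (P.pred (P.glue c)) = c := by
  rw [turn, succ_pred, glue_glue]

/-- Turning around a marked point, one always arrives at the boundary. -/
def Terminates : Prop := ∀ c, ∃ k, ¬ P.IsArc (P.succ (P.turn^[k] c))

/-- The last corner at the same marked point. -/
noncomputable def root : P.Side → P.Side := firstHit P.turn fun c => ¬ P.IsArc (P.succ c)

theorem fin_turn {c : P.Side} (h : P.IsArc (P.succ c)) : P.fin (P.turn c) = P.fin c :=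
  Quot.sound ⟨P.isArc_turn.2 h, by rw [turn, glue_glue, pred_succ]⟩

theorem ini_eq (d : P.Side) : P.ini d = P.fin (P.pred d) := rfl

theorem ini_succ (d : P.Side) : P.ini (P.succ d) = P.fin d := by
  rw [ini_eq, pred_succ]

theorem fin_root (c : P.Side) : P.fin (P.root c) = P.fin c := by
  suffices ∀ k ≤ hitTime P.turn (fun c => ¬ P.IsArc (P.succ c)) c, P.fin (P.turn^[k] c) = P.fin c
    from this _ le_rfl
  intro k hk
  induction k with
  | zero => rfl
  | succ k ih =>
    rw [Function.iterate_succ_apply', fin_turn, ih (by omega)]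
    exact not_not.1 (not_of_lt_hitTime (p := fun c => ¬ P.IsArc (P.succ c)) hk)

variable {P}

theorem Terminates.not_isArc_succ_root (hP : P.Terminates) (c : P.Side) :
    ¬ P.IsArc (P.succ (P.root c)) :=
  firstHit_spec (p := fun c => ¬ P.IsArc (P.succ c)) (hP c)

theorem root_of_not_isArc {c : P.Side} (h : ¬ P.IsArc (P.succ c)) : P.root c = c :=
  firstHit_of h

theorem Terminates.root_turn (hP : P.Terminates) {c : P.Side} (h : P.IsArc (P.succ c)) :
    P.root (P.turn c) = P.root c :=
  firstHit_apply (hP c) (not_not.2 h)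

/-- The root is unchanged by the generating relation of `Marked`, so it is an invariant of the
marked point. -/
theorem Terminates.root_eq (hP : P.Terminates) {c c' : P.Side} (h : P.fin c = P.fin c') :
    P.root c = P.root c' := by
  refine congrArg (Quot.lift P.root ?_) h
  rintro a b ⟨ha, rfl⟩
  rw [← hP.root_turn (c := P.pred (P.glue a)) (by rwa [succ_pred, isArc_glue]), turn_pred_glue]

theorem root_eq_or (c : P.Side) : P.root c = c ∨ P.IsArc (P.root c) := by
  rcases firstHit_eq_or (f := P.turn) (p := fun c => ¬ P.IsArc (P.succ c)) c with h | ⟨z, hz, h⟩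
  · exact .inl h
  · rw [root, ← h, isArc_turn]
    exact .inr (not_not.1 hz)

theorem isArc_root {c : P.Side} (h : P.IsArc c) : P.IsArc (P.root c) :=
  (root_eq_or c).elim (fun h' => h'.symm ▸ h) id

/-- A corner at which a boundary side ends is not the result of a rotation across an arc, so it is
the first corner at its marked point. -/
theorem eq_of_root_eq {c c' : P.Side} (h : P.root c = P.root c') (hc : ¬ P.IsArc c)
    (hc' : ¬ P.IsArc c') : c = c' := by
  rcases eq_or_of_firstHit_eq P.turn_injective h with h | ⟨z, hz, rfl⟩ | ⟨z, hz, rfl⟩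
  · exact h
  · exact absurd (P.isArc_turn.2 (not_not.1 hz)) hc
  · exact absurd (P.isArc_turn.2 (not_not.1 hz)) hc'

/-- A rotation that never meets the boundary closes up, since `turn` is injective on a finite set,
and then it exhausts all corners at the marked point; so no boundary side starts or ends there.
Conversely the side after the root is a boundary side starting at the point. -/
theorem isAngulation_iff_terminates : P.IsAngulation ↔ P.Terminates := by
  constructor
  · intro hP c
    by_contra! hc
    -- The orbit is periodic, hence also closed under inverse rotation; this makes membership in it
    -- invariant in both directions of the gluing relation.
    have hper : ∀ x, (∃ k, P.turn^[k] c = x) → ∃ z, (∃ k, P.turn^[k] c = z) ∧ P.turn z = x := by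
      rintro _ ⟨k, rfl⟩
      cases k with
      | zero =>
        obtain ⟨n, hn, hc⟩ := P.turn_injective.mem_periodicPts c
        refine ⟨_, ⟨n - 1, rfl⟩, ?_⟩
        rw [← Function.iterate_succ_apply' P.turn, Nat.succ_eq_add_one, Nat.sub_add_cancel hn]
        exact hc
      | succ k => exact ⟨_, ⟨k, rfl⟩, (Function.iterate_succ_apply' _ _ _).symm⟩
    have hinv : ∀ x, P.fin c = P.fin x → ∃ k, P.turn^[k] c = x := by
      intro x hx
      have := congrArg (Quot.lift (fun x => ∃ k, P.turn^[k] c = x) ?_) hx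
      · exact this.mp ⟨0, rfl⟩
      · rintro a b ⟨ha, rfl⟩
        refine propext ⟨fun h => ?_, ?_⟩
        · obtain ⟨z, hz, rfl⟩ := hper a h
          rwa [turn, glue_glue, pred_succ]
        · rintro ⟨k, hk⟩
          exact ⟨k + 1, by rw [Function.iterate_succ_apply', hk, turn_pred_glue]⟩
    obtain ⟨⟨d, hd⟩, h | h⟩ := hP (P.fin c)
    · obtain ⟨k, hk⟩ := hinv _ h.symm
      have := hc k
      rw [hk, succ_pred] at this
      exact this hd
    · obtain ⟨z, ⟨k, rfl⟩, rfl⟩ := hper _ (hinv _ h.symm)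
      exact P.isArc_turn.2 (hc k) hd
  · rintro hP ⟨c⟩
    refine ⟨⟨_, not_not.1 (hP.not_isArc_succ_root c)⟩, .inl ?_⟩
    rw [ini_succ, fin_root]
    rfl

/-! ### Starting points of runs of arcs -/

theorem BdrySide.not_isArc (d : P.BdrySide) : ¬ P.IsArc d.1 := not_not.2 d.2

variable (P) in
/-- The first side of an arc that follows a given side in its polygon. -/
noncomputable def nextArc : P.Side → P.Side := firstHit P.succ P.IsArc

variable (P) in
/-- Every polygon has an arc as a side. -/
def HasArcs : Prop := ∀ f : P.Face, ∃ i : ZMod (m + 2), P.IsArc (f, i)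

theorem HasArcs.exists_iterate (hT : P.HasArcs) (d : P.Side) : ∃ k, P.IsArc (P.succ^[k] d) := by
  obtain ⟨i, hi⟩ := hT d.1
  obtain ⟨k, -, hk⟩ := P.exists_succ_iterate_eq (d := d) (d' := (d.1, i)) rfl
  exact ⟨k, hk ▸ hi⟩

theorem HasArcs.isArc_nextArc (hT : P.HasArcs) (d : P.Side) : P.IsArc (P.nextArc d) :=
  firstHit_spec (hT.exists_iterate d)

theorem HasArcs.nextArc_succ (hT : P.HasArcs) {d : P.Side} (h : ¬ P.IsArc d) :
    P.nextArc (P.succ d) = P.nextArc d :=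
  firstHit_apply (hT.exists_iterate d) h

theorem nextArc_of_isArc {d : P.Side} (h : P.IsArc d) : P.nextArc d = d := firstHit_of h

theorem nextArc_fst (d : P.Side) : (P.nextArc d).1 = d.1 := by
  rw [nextArc, firstHit, succ_iterate]

theorem not_isArc_pred_nextArc {d : P.Side} (h : ¬ P.IsArc d) (h' : P.IsArc (P.nextArc d)) :
    ¬ P.IsArc (P.pred (P.nextArc d)) := by
  rcases firstHit_eq_or (f := P.succ) (p := P.IsArc) d with h1 | ⟨z, hz, h1⟩
  · rw [nextArc, h1] at h'
    exact absurd h' h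
  · rwa [nextArc, ← h1, pred_succ]

variable (P) in
/-- The sides of arcs with which the runs of arcs start. -/
abbrev Start : Type u := {s : P.Side // P.IsArc s ∧ ¬ P.IsArc (P.pred s)}

/-- The boundary side in front of a run of arcs. -/
def Start.bdry (s : P.Start) : P.BdrySide := ⟨P.pred s.1, not_not.1 s.2.2⟩

/-- The run of arcs that follows a boundary side. -/
noncomputable def HasArcs.toStart (hT : P.HasArcs) (d : P.BdrySide) : P.Start :=
  ⟨P.nextArc d.1, hT.isArc_nextArc _, not_isArc_pred_nextArc d.not_isArc (hT.isArc_nextArc _)⟩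

theorem HasArcs.nextArc_bdry (hT : P.HasArcs) (s : P.Start) : P.nextArc s.bdry.1 = s.1 := by
  rw [← hT.nextArc_succ s.bdry.not_isArc, Start.bdry, succ_pred, nextArc_of_isArc s.2.1]

theorem HasArcs.toStart_bdry (hT : P.HasArcs) (s : P.Start) : hT.toStart s.bdry = s :=
  Subtype.ext (hT.nextArc_bdry s)

theorem Start.bdry_injective : Function.Injective (Start.bdry : P.Start → P.BdrySide) :=
  fun s s' h => Subtype.ext <| by
    rw [← P.succ_pred s.1, ← P.succ_pred s'.1]
    exact congrArg (fun d => P.succ d.1) h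

/-- A quantity that is constant along consecutive boundary sides of a polygon can be evaluated at
the last one before the next run. The induction is on the number of sides up to that run. -/
theorem HasArcs.apply_bdry_toStart (hT : P.HasArcs) {Z : Sort*} {q : P.BdrySide → Z}
    (hq : ∀ d d' : P.BdrySide, d'.1 = P.succ d.1 → q d' = q d) (d : P.BdrySide) :
    q (hT.toStart d).bdry = q d := by
  induction hn : hitTime P.succ P.IsArc d.1 generalizing d with
  | zero =>
    have := hitTime_pos (hT.exists_iterate d.1) d.not_isArc
    omega
  | succ n ih =>
    by_cases h : P.IsArc (P.succ d.1)
    · congr 1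
      apply Subtype.ext
      change P.pred (P.nextArc d.1) = d.1
      rw [← hT.nextArc_succ d.not_isArc, nextArc_of_isArc h, pred_succ]
    · let d' : P.BdrySide := ⟨P.succ d.1, not_not.1 h⟩
      have h1 : hT.toStart d' = hT.toStart d := Subtype.ext (hT.nextArc_succ d.not_isArc)
      have h2 := hitTime_apply (hT.exists_iterate d.1) d.not_isArc
      rw [← h1, ih d' (by simp only [d']; omega), hq d d' rfl]

/-! ### Going along the boundary from run to run -/

/-- The boundary side that follows a given one on the boundary. -/
noncomputable def Terminates.next (hP : P.Terminates) (d : P.Side) : P.BdrySide :=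
  ⟨P.succ (P.root d), not_not.1 (hP.not_isArc_succ_root d)⟩

theorem Terminates.next_val (hP : P.Terminates) (d : P.Side) :
    (hP.next d).1 = P.succ (P.root d) := rfl

theorem Terminates.fin_eq_ini_iff (hP : P.Terminates) (c : P.Side) (d : P.BdrySide) :
    P.fin c = P.ini d.1 ↔ d = hP.next c := by
  constructor
  · intro h
    have := hP.root_eq h
    rw [root_of_not_isArc (c := P.pred d.1) (by rw [succ_pred]; exact d.not_isArc)] at this
    apply Subtype.ext
    rw [next_val, this, succ_pred]
  · rintro rfl
    rw [next, ini_succ, fin_root]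

/-- If the side after `d` is also on the boundary, then `d` is the only corner at its end point, and
no arc reaches that point. -/
theorem Terminates.fin_mem_markedT_iff (hP : P.Terminates) (d : P.BdrySide) :
    P.fin d.1 ∈ P.markedT ↔ P.IsArc (P.succ d.1) := by
  constructor
  · rintro ⟨⟨a, ha⟩, h⟩
    by_contra hd
    have key : ∀ c, P.fin c = P.fin d.1 → c = d.1 := fun c hc => by
      have h1 := hP.root_eq hc
      rw [root_of_not_isArc hd] at h1
      rcases root_eq_or c with h2 | h2
      · exact h2.symm.trans h1
      · exact absurd (h1 ▸ h2) d.not_isArc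
    rcases h with h | h
    · apply hd
      rw [← key _ h, succ_pred]
      exact ha
    · exact d.not_isArc (key _ h ▸ ha)
  · intro h
    exact ⟨⟨_, h⟩, .inl (P.ini_succ _)⟩

theorem Terminates.fin_injective (hP : P.Terminates) :
    Function.Injective fun d : P.BdrySide => P.fin d.1 := fun d d' h =>
  Subtype.ext (eq_of_root_eq (hP.root_eq h) d.not_isArc d'.not_isArc)

theorem Start.fin_bdry_mem (s : P.Start) : P.fin s.bdry.1 ∈ P.markedT :=
  ⟨⟨s.1, s.2.1⟩, .inl rfl⟩

/-- Since an arc follows this corner, the rotation makes at least one step, and every step of it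
lands on an arc side. -/
theorem Terminates.isArc_root_bdry (hP : P.Terminates) (s : P.Start) :
    P.IsArc (P.root s.bdry.1) := by
  have h : P.IsArc (P.succ s.bdry.1) := by
    rw [Start.bdry, succ_pred]; exact s.2.1
  rw [← hP.root_turn h]
  exact isArc_root (P.isArc_turn.2 h)

/-- The run of arcs that comes next on the boundary. -/
noncomputable def nextStart (hP : P.Terminates) (hT : P.HasArcs) (s : P.Start) : P.Start :=
  hT.toStart (hP.next s.bdry.1)

/-- The boundary side reached after rotating is directly preceded by an arc side, so it is the first
of its block of boundary sides and is determined by the run that follows. The root then determines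
the initial boundary side. -/
theorem nextStart_injective (hP : P.Terminates) (hT : P.HasArcs) :
    Function.Injective (nextStart hP hT) := by
  intro s s' h
  apply Start.bdry_injective
  apply Subtype.ext
  refine eq_of_root_eq ?_ s.bdry.not_isArc s'.bdry.not_isArc
  rcases eq_or_of_firstHit_eq P.succ_injective (congrArg Subtype.val h) with h | ⟨z, hz, h⟩ |
    ⟨z, hz, h⟩
  · exact P.succ_injective h
  · exact absurd ((P.succ_injective h).symm ▸ hP.isArc_root_bdry s) hz
  · exact absurd ((P.succ_injective h).symm ▸ hP.isArc_root_bdry s') hz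

/-- The permutation of the runs of arcs given by going along the boundary. -/
noncomputable def startPerm (hP : P.Terminates) (hT : P.HasArcs) : Equiv.Perm P.Start :=
  Equiv.ofBijective _ (Finite.injective_iff_bijective.1 (nextStart_injective hP hT))

theorem startPerm_apply (hP : P.Terminates) (hT : P.HasArcs) (s : P.Start) :
    startPerm hP hT s = hT.toStart (hP.next s.bdry.1) := rfl

theorem startPerm_symm (hP : P.Terminates) (hT : P.HasArcs) (s : P.Start) :
    hT.toStart (hP.next ((startPerm hP hT).symm s).bdry.1) = s :=
  (startPerm hP hT).apply_symm_apply s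

/-! ### Boundary components -/

/-- The boundary component of the boundary side in front of a run. -/
def Start.component (s : P.Start) : P.Component := Quot.mk _ s.bdry

theorem component_toStart (hT : P.HasArcs) (d : P.BdrySide) :
    (hT.toStart d).component = Quot.mk _ d :=
  hT.apply_bdry_toStart (q := fun d => (Quot.mk _ d : P.Component))
    (fun d d' h => (Quot.sound (by rw [h, ini_succ])).symm) d

theorem component_next (hP : P.Terminates) (d : P.BdrySide) :
    (Quot.mk _ (hP.next d.1) : P.Component) = Quot.mk _ d := by
  have h : P.fin d.1 = P.ini (hP.next d.1).1 := (hP.fin_eq_ini_iff _ _).2 rfl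
  exact (Quot.sound (r := fun d d' : P.BdrySide => P.fin d.1 = P.ini d'.1) h).symm

theorem component_surjective (hT : P.HasArcs) :
    Function.Surjective (Start.component : P.Start → P.Component) := by
  rintro ⟨d⟩
  exact ⟨_, component_toStart hT d⟩

theorem component_eq_iff (hP : P.Terminates) (hT : P.HasArcs) (s s' : P.Start) :
    s.component = s'.component ↔ (startPerm hP hT).SameCycle s s' := by
  constructor
  · intro h
    -- The cycle of the following start is invariant along the boundary: passing to the next
    -- boundary side either stays in front of the same run or applies `startPerm` once.
    let q : P.BdrySide → Quotient (Equiv.Perm.SameCycle.setoid (startPerm hP hT)) :=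
      fun d => Quotient.mk _ (hT.toStart d)
    have hq : ∀ d d' : P.BdrySide, P.fin d.1 = P.ini d'.1 → q d = q d' := by
      intro d d' hd
      obtain rfl := (hP.fin_eq_ini_iff _ _).1 hd
      by_cases h : P.IsArc (P.succ d.1)
      · apply Quotient.sound
        have h1 : (hT.toStart d).bdry = d := by
          apply Subtype.ext
          change P.pred (P.nextArc d.1) = d.1
          rw [← hT.nextArc_succ d.not_isArc, nextArc_of_isArc h, pred_succ]
        have h2 := startPerm_apply hP hT (hT.toStart d)
        rw [h1] at h2
        exact ⟨1, by rw [zpow_one, h2]⟩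
      · refine congrArg (Quotient.mk _) (Subtype.ext ?_)
        change P.nextArc d.1 = P.nextArc (P.succ (P.root d.1))
        rw [root_of_not_isArc h, hT.nextArc_succ d.not_isArc]
    have h1 : q s.bdry = q s'.bdry := congrArg (Quot.lift q hq) h
    simp only [q, hT.toStart_bdry] at h1
    exact Quotient.exact h1
  · intro h
    obtain ⟨i, -, rfl⟩ := h.exists_pow_eq'
    clear h
    induction i with
    | zero => rfl
    | succ i ih =>
      rw [ih, pow_succ', Equiv.Perm.mul_apply, startPerm_apply, component_toStart, component_next]
      rfl

/-- Each point of `M_T` is the end of exactly one boundary side, and that side lies directly in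
front of a run. -/
theorem numMarkedT_eq (hP : P.Terminates) (hT : P.HasArcs) (i : P.Component) :
    i.numMarkedT = {s : P.Start | s.component = i}.ncard := by
  rw [← Set.ncard_image_of_injective _ (hP.fin_injective.comp Start.bdry_injective),
    Component.numMarkedT]
  congr 1
  ext p
  constructor
  · rintro ⟨hp, d, rfl, h⟩
    have key : ∀ d : P.BdrySide, P.fin d.1 ∈ P.markedT → ∃ s : P.Start, s.bdry = d := fun d hd => by
      refine ⟨⟨P.succ d.1, (hP.fin_mem_markedT_iff d).1 hd, ?_⟩, Subtype.ext (P.pred_succ _)⟩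
      rw [pred_succ]
      exact d.not_isArc
    rcases h with rfl | rfl
    · obtain ⟨s, hs⟩ : ∃ s : P.Start, P.fin s.bdry.1 = P.ini d.1 := by
        -- If an arc side precedes `d`, then `d` opens a block of boundary sides, and the required
        -- start is the predecessor under `startPerm` of the run after that block. Otherwise the
        -- preceding boundary side ends at the same point.
        by_cases h : P.IsArc (P.pred d.1)
        · have hfin : ∀ e : P.Start, hP.next e.bdry.1 = d → P.fin e.bdry.1 = P.ini d.1 :=
            fun e he => (hP.fin_eq_ini_iff _ _).2 he.symm
          refine ⟨(startPerm hP hT).symm (hT.toStart d), hfin _ ?_⟩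
          have h2 := congrArg Subtype.val (startPerm_symm hP hT (hT.toStart d))
          apply Subtype.ext
          rcases eq_or_of_firstHit_eq P.succ_injective h2 with h | ⟨z, hz, h3⟩ | ⟨z, hz, h3⟩
          · exact h
          · exact absurd ((P.succ_injective h3).symm ▸ hP.isArc_root_bdry _) hz
          · rw [← h3, pred_succ] at h
            exact absurd h hz
        · obtain ⟨s, hs⟩ := key ⟨P.pred d.1, not_not.1 h⟩ hp
          exact ⟨s, by rw [hs, ini_eq]⟩
      refine ⟨s, ?_, hs⟩
      rw [Set.mem_ofPred_eq, Start.component, ← component_next hP,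
        ← (hP.fin_eq_ini_iff _ _).1 hs]
    · obtain ⟨s, rfl⟩ := key d hp
      exact ⟨s, rfl, rfl⟩
  · rintro ⟨s, rfl, rfl⟩
    exact ⟨s.fin_bdry_mem, s.bdry, rfl, .inr rfl⟩

/-! ### Segments of the boundary -/

/-- Away from `M_T` the boundary continues inside the same polygon, so a piece is a block of
consecutive boundary sides and is named by the arc side that follows it. -/
theorem piece_eq_iff (hP : P.Terminates) (hT : P.HasArcs) (d d' : P.BdrySide) :
    (Quot.mk _ d : P.Piece) = Quot.mk _ d' ↔ P.nextArc d.1 = P.nextArc d'.1 := by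
  constructor
  · intro h
    refine congrArg (Quot.lift (fun d : P.BdrySide => P.nextArc d.1) ?_) h
    rintro a b ⟨h1, h2⟩
    rw [hP.fin_mem_markedT_iff] at h2
    rw [(hP.fin_eq_ini_iff _ _).1 h1, hP.next_val, root_of_not_isArc h2,
      hT.nextArc_succ a.not_isArc]
  · intro h
    have key := hT.apply_bdry_toStart (q := fun d => (Quot.mk _ d : P.Piece)) fun d d' h =>
      (Quot.sound ⟨by rw [h, ini_succ], by
        rw [hP.fin_mem_markedT_iff, ← h]; exact d'.not_isArc⟩).symm
    rw [← key d, ← key d']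
    have : hT.toStart d = hT.toStart d' := Subtype.ext h
    rw [this]

theorem exists_piece_ini_mem (hP : P.Terminates) (hT : P.HasArcs) (s : P.Start) :
    ∃ d : P.BdrySide, (Quot.mk _ d : P.Piece) = Quot.mk _ s.bdry ∧ P.ini d.1 ∈ P.markedT := by
  refine ⟨hP.next ((startPerm hP hT).symm s).bdry.1, ?_, ?_⟩
  · rw [piece_eq_iff hP hT, hT.nextArc_bdry]
    exact congrArg Subtype.val (startPerm_symm hP hT s)
  · rw [← (hP.fin_eq_ini_iff _ _).2 rfl]
    exact Start.fin_bdry_mem _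

/-- The segment of the boundary in front of a run of arcs. -/
noncomputable def Start.segment (hP : P.Terminates) (hT : P.HasArcs) (s : P.Start) : P.Segment :=
  ⟨Quot.mk _ s.bdry, exists_piece_ini_mem hP hT s, s.bdry, rfl, s.fin_bdry_mem⟩

theorem hasSide_segment_iff (hP : P.Terminates) (hT : P.HasArcs) (s : P.Start) (d : P.BdrySide) :
    (s.segment hP hT).HasSide d ↔ P.nextArc d.1 = s.1 :=
  (piece_eq_iff hP hT d s.bdry).trans (by rw [hT.nextArc_bdry])

theorem segment_bijective (hP : P.Terminates) (hT : P.HasArcs) :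
    Function.Bijective (Start.segment hP hT) := by
  constructor
  · intro s s' h
    have h1 := (hasSide_segment_iff hP hT s' s.bdry).1 (congrArg Subtype.val h)
    rw [hT.nextArc_bdry] at h1
    exact Subtype.ext h1
  · rintro ⟨⟨d⟩, h⟩
    refine ⟨hT.toStart d, Subtype.ext ((piece_eq_iff hP hT _ _).2 ?_)⟩
    rw [hT.nextArc_bdry]
    rfl

/-- The segment consists of the `j` boundary sides from `e` to the next run. Its `j - 1` inner
points are outside `M_T`, while its two end points belong to it. -/
theorem segment_weight (hP : P.Terminates) (hT : P.HasArcs) (s : P.Start) :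
    ((startPerm hP hT s).segment hP hT).weight =
      hitTime P.succ P.IsArc (hP.next s.bdry.1).1 - 1 := by
  set e := hP.next s.bdry.1
  set j := hitTime P.succ P.IsArc e.1
  have hej := hT.exists_iterate e.1
  have h1 : ∀ i < j, ¬ P.IsArc (P.succ^[i] e.1) := fun i hi => not_of_lt_hitTime hi
  have hinj : Set.InjOn (fun i => P.succ^[i] e.1) (Set.Iio j) := fun i hi i' hi' h => by
    have h2 := hitTime_iterate hej (le_of_lt hi)
    have h3 := hitTime_iterate hej (le_of_lt hi')
    rw [show P.succ^[i] e.1 = _ from h, h3] at h2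
    simp only [Set.mem_Iio] at hi hi'
    omega
  have hside : ∀ d : P.BdrySide, ((startPerm hP hT s).segment hP hT).HasSide d ↔
      ∃ i < j, d.1 = P.succ^[i] e.1 := fun d => by
    rw [hasSide_segment_iff, startPerm_apply]
    constructor
    · intro h
      rcases le_or_gt (hitTime P.succ P.IsArc d.1) j with hd | hd
      · have := hitTime_pos (hT.exists_iterate d.1) d.not_isArc
        exact ⟨_, by omega, eq_iterate_of_firstHit_eq P.succ_injective h hd⟩
      · have h2 := eq_iterate_of_firstHit_eq P.succ_injective h.symm hd.le
        rw [show hitTime P.succ P.IsArc d.1 - hitTime P.succ P.IsArc e.1 =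
          (hitTime P.succ P.IsArc d.1 - hitTime P.succ P.IsArc e.1 - 1) + 1 by
            simp only [j] at hd; omega, Function.iterate_succ_apply'] at h2
        have h3 := P.succ_injective h2
        exact absurd (h3 ▸ hP.isArc_root_bdry s) (not_of_lt_hitTime (by simp only [j] at hd; omega))
    · rintro ⟨i, hi, h⟩
      rw [h]
      exact firstHit_iterate hej hi.le
  have himg : {p : P.Marked | (∃ d, ((startPerm hP hT s).segment hP hT).HasSide d ∧
      (P.ini d.1 = p ∨ P.fin d.1 = p)) ∧ p ∉ P.markedT} =
      (fun i => P.fin (P.succ^[i] e.1)) '' Set.Iio (j - 1) := by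
    ext p
    constructor
    · rintro ⟨⟨d, hd, h⟩, hp⟩
      obtain ⟨i, hi, hd⟩ := (hside d).1 hd
      rcases h with rfl | rfl
      · cases i with
        | zero =>
          refine absurd ?_ hp
          rw [show d = e from Subtype.ext hd, ← (hP.fin_eq_ini_iff _ _).2 rfl]
          exact s.fin_bdry_mem
        | succ i =>
          refine ⟨i, Nat.lt_sub_of_add_lt hi, ?_⟩
          rw [hd, Function.iterate_succ_apply', ini_succ]
      · refine ⟨i, ?_, by rw [hd]⟩
        by_contra hi'
        have hi2 : i + 1 = j := by
          simp only [Set.mem_Iio, not_lt] at hi'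
          omega
        apply hp
        rw [hP.fin_mem_markedT_iff, hd, ← Function.iterate_succ_apply' P.succ, Nat.succ_eq_add_one, hi2]
        exact firstHit_spec hej
    · rintro ⟨i, hi, rfl⟩
      have hi : i < j - 1 := hi
      let d : P.BdrySide := ⟨P.succ^[i] e.1, not_not.1 (h1 i (by omega))⟩
      refine ⟨⟨d, (hside d).2 ⟨i, by omega, rfl⟩, .inr rfl⟩, ?_⟩
      change P.fin d.1 ∉ _
      rw [hP.fin_mem_markedT_iff, ← Function.iterate_succ_apply' P.succ i e.1]
      exact h1 _ (Nat.add_lt_of_lt_sub hi)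
  have hinj2 : Set.InjOn (fun i => P.fin (P.succ^[i] e.1)) (Set.Iio (j - 1)) := by
    intro i hi i' hi' h
    have hi : i < j - 1 := hi
    have hi' : i' < j - 1 := hi'
    have := eq_of_root_eq (hP.root_eq h) (h1 i (by omega)) (h1 i' (by omega))
    exact hinj (show i < j by omega) (show i' < j by omega) this
  rw [Segment.weight, himg, hinj2.ncard_image, ← Finset.coe_range, Set.ncard_coe_finset,
    Finset.card_range]

theorem weightSum_eq (hP : P.Terminates) (hT : P.HasArcs) (i : P.Component) :
    i.weightSum = ∑ᶠ s ∈ {s : P.Start | s.component = i},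
      ((m : ℤ) - ((s.segment hP hT).weight : ℤ)) := by
  rw [Component.weightSum]
  rw [finsum_subtype_eq_finsum_cond (fun b : P.Segment => b.component = i)
    (f := fun b : P.Segment => (m : ℤ) - (b.weight : ℤ))]
  symm
  have hb := segment_bijective hP hT
  refine finsum_mem_eq_of_bijOn (t := {b : P.Segment | b.component = i}) (Start.segment hP hT)
    ⟨fun s hs => hs, hb.1.injOn, fun b hb' => ?_⟩ fun _ _ => rfl
  obtain ⟨s, rfl⟩ := hb.2 b
  exact ⟨s, hb', rfl⟩

end PolygonGluing

namespace PolygonGluing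

variable {m : ℕ} {P : PolygonGluing.{u} m}

/-! ## The AG-invariant of a surface all of whose polygons contain a single run of arcs -/

theorem arc_eq_iff (d d' : P.ArcSide) : P.arc d = P.arc d' ↔ d' = d ∨ d' = P.flip d := by
  constructor
  · intro h
    have := congrArg (Quot.lift (fun e : P.ArcSide => d' = e ∨ d' = P.flip e) ?_) h
    · exact this.mpr (.inl rfl)
    · rintro a _ rfl
      simp only [flip_flip, or_comm]
  · rintro (rfl | rfl)
    · rfl
    · exact Quot.sound rfl

variable (P) in
/-- The ribbon description of `P.quiver` by the sides of arcs. -/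
def ribbon : P.quiver.Ribbon P.ArcSide where
  flip := P.flip
  flip_flip := P.flip_flip
  flip_ne d h := d.2 (congrArg Subtype.val h)
  vert := P.arc
  vert_surjective := Quot.exists_rep
  vert_eq_iff := arc_eq_iff
  src a := ⟨a.1, a.2.1⟩
  tgt a := ⟨P.succ a.1, a.2.2⟩
  src_injective _ _ h := Subtype.ext (congrArg (fun d : P.ArcSide => d.1) h)
  tgt_injective _ _ h :=
    Subtype.ext (P.succ_injective (congrArg (fun d : P.ArcSide => d.1) h))
  s_eq _ := rfl
  t_eq _ := rfl
  rel_iff a b := by rw [Subtype.ext_iff]; rfl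

variable (P) in
/-- No polygon contains two runs of arcs. -/
def HasUniqueStarts : Prop := ∀ s s' : P.Start, s.1.1 = s'.1.1 → s = s'

/-! ### Threads read on the surface -/

section Iso

variable {Q : BoundQuiver.{u}} (e : Q.Iso P.quiver)

theorem ribbon_tgt (a : Q.A) :
    ((P.ribbon.ofIso e).tgt a).1 = P.succ ((P.ribbon.ofIso e).src a).1 := rfl

theorem ribbon_turn (a : Q.A) :
    ((P.ribbon.ofIso e).turn a).1 = P.turn ((P.ribbon.ofIso e).src a).1 := rfl

theorem isArc_succ_src (a : Q.A) : P.IsArc (P.succ ((P.ribbon.ofIso e).src a).1) :=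
  (e.arrow a).2.2

theorem mem_range_src_iff (d : P.ArcSide) :
    d ∈ Set.range (P.ribbon.ofIso e).src ↔ P.IsArc (P.succ d.1) := by
  constructor
  · rintro ⟨a, rfl⟩
    exact isArc_succ_src e a
  · intro h
    refine ⟨e.arrow.symm ⟨d.1, d.2, h⟩, ?_⟩
    exact congrArg P.ribbon.src (e.arrow.apply_symm_apply _)

theorem mem_range_tgt_iff (d : P.ArcSide) :
    d ∈ Set.range (P.ribbon.ofIso e).tgt ↔ P.IsArc (P.pred d.1) := by
  constructor
  · rintro ⟨a, rfl⟩
    rw [ribbon_tgt, pred_succ]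
    exact ((P.ribbon.ofIso e).src a).2
  · intro h
    refine ⟨e.arrow.symm ⟨P.pred d.1, h, by rw [succ_pred]; exact d.2⟩, ?_⟩
    exact (congrArg P.ribbon.tgt (e.arrow.apply_symm_apply _)).trans
      (Subtype.ext (P.succ_pred _))

/-- Consequently the sides at which permitted threads begin are the flips of the elements of
`Start`. -/
theorem mem_range_turn_iff (d : P.ArcSide) :
    P.flip d ∈ Set.range (P.ribbon.ofIso e).turn ↔ P.IsArc (P.pred d.1) := by
  rw [← mem_range_tgt_iff e]
  constructor
  · rintro ⟨a, ha⟩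
    exact ⟨a, (P.ribbon.ofIso e).flip_injective ha⟩
  · rintro ⟨a, ha⟩
    exact ⟨a, congrArg P.flip ha⟩

theorem rank_turn_lt (hP : P.Terminates) (a : Q.A) :
    hitTime P.turn (fun c => ¬ P.IsArc (P.succ c)) ((P.ribbon.ofIso e).turn a).1 <
      hitTime P.turn (fun c => ¬ P.IsArc (P.succ c)) ((P.ribbon.ofIso e).src a).1 := by
  have := hitTime_apply (p := fun c => ¬ P.IsArc (P.succ c)) (hP ((P.ribbon.ofIso e).src a).1) (not_not.2 (isArc_succ_src e a))
  rw [ribbon_turn]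
  omega

theorem isGentle_of_iso (e : Q.Iso P.quiver) (hP : P.Terminates) : Q.IsGentle :=
  BoundQuiver.Ribbon.isGentle (P.ribbon.ofIso e)
    (rank := fun d => hitTime P.turn (fun c => ¬ P.IsArc (P.succ c)) d.1) (rank_turn_lt e hP)

variable {e}

theorem root_of_isWalk (hP : P.Terminates) {d c : P.ArcSide} {l : List Q.A}
    (h : (P.ribbon.ofIso e).IsWalk (P.ribbon.ofIso e).turn d l c)
    (hc : c ∉ Set.range (P.ribbon.ofIso e).src) : P.root d.1 = c.1 := by
  induction l generalizing d with
  | nil =>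
    obtain rfl : d = c := h
    rw [mem_range_src_iff] at hc
    exact root_of_not_isArc hc
  | cons a l ih =>
    obtain ⟨rfl, h⟩ := h
    rw [← ih h, ribbon_turn, hP.root_turn (isArc_succ_src e a)]

theorem iterate_of_isWalk {d c : P.ArcSide} {l : List Q.A}
    (h : (P.ribbon.ofIso e).IsWalk (P.ribbon.ofIso e).tgt d l c) :
    c.1 = P.succ^[l.length] d.1 ∧ ∀ i ≤ l.length, P.IsArc (P.succ^[i] d.1) := by
  induction l generalizing d with
  | nil =>
    obtain rfl : d = c := h
    refine ⟨rfl, fun i hi => ?_⟩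
    rw [Nat.le_zero.1 hi]
    exact d.2
  | cons a l ih =>
    obtain ⟨rfl, h⟩ := h
    obtain ⟨h1, h2⟩ := ih h
    refine ⟨h1, fun i hi => ?_⟩
    cases i with
    | zero => exact ((P.ribbon.ofIso e).src a).2
    | succ i => exact h2 i (Nat.le_of_succ_le_succ hi)

/-- The forbidden walk ends at the root `c`, just before the boundary block leading to the next
start, so its first side and that start lie in one polygon and coincide by uniqueness. The walk
covers `l.length + 1` arc sides and the block `weight + 1` boundary sides, together `m + 2`. -/
theorem startPerm_eq_of_isWalk (hP : P.Terminates) (hT : P.HasArcs) (hS : P.HasUniqueStarts)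
    {s : P.Start} {d c : P.ArcSide} {l : List Q.A}
    (h : (P.ribbon.ofIso e).IsWalk (P.ribbon.ofIso e).tgt d l c)
    (hd : d ∉ Set.range (P.ribbon.ofIso e).tgt) (hc : P.root s.bdry.1 = c.1) :
    (startPerm hP hT s).1 = d.1 ∧
      l.length + ((startPerm hP hT s).segment hP hT).weight = m := by
  rw [mem_range_tgt_iff] at hd
  obtain ⟨h1, h2⟩ := iterate_of_isWalk h
  have hs : (startPerm hP hT s).1 = d.1 := by
    refine congrArg Subtype.val (hS (startPerm hP hT s) ⟨d.1, d.2, hd⟩ ?_)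
    rw [startPerm_apply]
    change (P.nextArc (P.succ (P.root s.bdry.1))).1 = d.1.1
    rw [nextArc_fst, hc, h1, succ_iterate]
    rfl
  refine ⟨hs, ?_⟩
  rw [segment_weight]
  have hnext : (hP.next s.bdry.1).1 = P.succ (P.succ^[l.length] d.1) := by
    rw [hP.next_val, hc, h1]
  have hs' : P.succ^[hitTime P.succ P.IsArc (hP.next s.bdry.1).1] (hP.next s.bdry.1).1 = d.1 := hs
  have hpos := hitTime_pos (hT.exists_iterate (hP.next s.bdry.1).1) (hP.next s.bdry.1).not_isArc
  -- After `m + 1` steps from the first boundary side one is back at the root, which is an arc side.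
  have hle : hitTime P.succ P.IsArc (hP.next s.bdry.1).1 ≤ m + 1 := by
    apply hitTime_le
    rw [hP.next_val, ← Function.iterate_succ_apply, succ_iterate]
    have h3 := hP.isArc_root_bdry s
    convert h3
    rw [show (((m + 1).succ : ℕ) : ZMod (m + 2)) = 0 from ZMod.natCast_self (m + 2), add_zero]
  -- A longer walk would reach `pred d`, making it an arc side, against the choice of `d`.
  have hl : l.length ≤ m := by
    by_contra! hl
    apply hd
    have h3 := h2 (m + 1) hl
    rw [← P.pred_succ (P.succ^[m + 1] d.1), ← Function.iterate_succ_apply' P.succ,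
      succ_iterate, show (((m + 1).succ : ℕ) : ZMod (m + 2)) = 0 from ZMod.natCast_self (m + 2),
      add_zero] at h3
    exact h3
  set j := hitTime P.succ P.IsArc (hP.next s.bdry.1).1
  rw [hnext, ← Function.iterate_succ_apply' P.succ, ← Function.iterate_add_apply,
    succ_iterate] at hs'
  have h5 := congrArg Prod.snd hs'
  simp only [add_eq_left] at h5
  obtain ⟨k, hk⟩ := (ZMod.natCast_eq_zero_iff _ _).1 h5
  -- The total number of steps is a positive multiple of `m + 2` and at most `2 * m + 2`.
  have hk1 : k = 1 := by
    have : k < 2 := by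
      by_contra! h6
      have := Nat.mul_le_mul_left (m + 2) h6
      omega
    interval_cases k
    · omega
    · rfl
  subst hk1
  omega

/-- The ribbon description is transported along `e`, so the signs and threads live on `Q` itself and
no invariance of the algorithm under isomorphism is needed. -/
theorem ncard_agOrbits_eq (e : Q.Iso P.quiver) (hP : P.Terminates) (hT : P.HasArcs) (hS : P.HasUniqueStarts)
    {σ ε : Q.A → ℤˣ} (h : Q.IsSignPair σ ε) (n l : ℕ) :
    (Q.agOrbits σ ε n l).ncard =
      {i : P.Component | i.numMarkedT = n ∧ i.weightSum = l}.ncard := by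
  obtain ⟨s, hs, rfl, rfl⟩ := (P.ribbon.ofIso e).exists_signs_of_isSignPair h
  choose L E hL hE using fun x : P.Start =>
    BoundQuiver.Ribbon.exists_isWalk (r := P.ribbon.ofIso e)
      (rank := fun d => hitTime P.turn (fun c => ¬ P.IsArc (P.succ c)) d.1)
      (rank_turn_lt e hP) (P.flip ⟨x.1, x.2.1⟩)
  have hturn : ∀ x : P.Start, P.flip ⟨x.1, x.2.1⟩ ∉ Set.range (P.ribbon.ofIso e).turn := fun x hx =>
    x.2.2 ((mem_range_turn_iff e _).1 hx)
  have hroot : ∀ x : P.Start, P.root x.bdry.1 = (E x).1 := fun x => by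
    rw [← root_of_isWalk hP (hL x) (hE x), ← hP.root_turn]
    · change P.root (P.glue (P.succ (P.pred x.1))) = P.root (P.glue x.1)
      rw [succ_pred]
    · change P.IsArc (P.succ (P.pred x.1))
      rw [succ_pred]
      exact x.2.1
  have hF : ∀ x : P.Start, ∃ d L', (P.ribbon.ofIso e).IsWalk (P.ribbon.ofIso e).tgt d L' (E x) ∧
      d ∉ Set.range (P.ribbon.ofIso e).tgt := fun x =>
    BoundQuiver.Ribbon.exists_isWalk_to (hE x)
  have hlen : ∀ x : P.Start, ((startPerm hP hT x).segment hP hT).weight ≤ m := fun x => by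
    obtain ⟨d, L', h1, h2⟩ := hF x
    have := (startPerm_eq_of_isWalk hP hT hS h1 h2 (hroot x)).2
    omega
  have heq : ∀ (x : P.Start) (d : P.ArcSide), x.1 = d.1 → P.flip d = P.flip ⟨x.1, x.2.1⟩ :=
    fun x d hx => congrArg P.flip (Subtype.ext hx.symm)
  rw [BoundQuiver.ncard_agOrbits (th := fun x : P.Start =>
      (P.ribbon.ofIso e).thread s (P.flip ⟨x.1, x.2.1⟩) (L x))
    (π := startPerm hP hT) (comp := Start.component)
    (ℓ := fun x => m - ((startPerm hP hT x).segment hP hT).weight)]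
  · congr 1
    ext i
    rw [Set.mem_ofPred_eq, Set.mem_ofPred_eq]
    rw [numMarkedT_eq hP hT, weightSum_eq hP hT]
    refine and_congr Iff.rfl ?_
    -- The forbidden thread met after the start `x` measures the segment in front of `startPerm x`;
    -- the sum over a component is reindexed by this shift.
    have hsum : ∑ᶠ x ∈ {x : P.Start | x.component = i}, ((m : ℤ) - ((x.segment hP hT).weight : ℤ)) =
        ((∑ᶠ x ∈ {x : P.Start | x.component = i},
          (m - ((startPerm hP hT x).segment hP hT).weight) : ℕ) : ℤ) := by
      rw [← Nat.coe_castAddMonoidHom (α := ℤ),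
        AddMonoidHom.map_finsum_mem _ _ (Set.toFinite _)]
      symm
      have hcomp : ∀ x : P.Start, (startPerm hP hT x).component = x.component := fun x =>
        ((component_eq_iff hP hT _ _).2 ⟨1, by rw [zpow_one]⟩).symm
      refine finsum_mem_eq_of_bijOn (startPerm hP hT) ⟨fun x hx => (hcomp x).trans hx,
        (startPerm hP hT).injective.injOn, fun x hx => ⟨(startPerm hP hT).symm x, ?_, by simp⟩⟩
        fun x _ => ?_
      · rw [Set.mem_ofPred_eq, ← hcomp, Equiv.apply_symm_apply]
        exact hx
      · rw [Nat.coe_castAddMonoidHom, Nat.cast_sub (hlen x)]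
    rw [hsum, Nat.cast_inj]
  · intro x y hxy
    have h1 := congrArg BoundQuiver.Thread.start hxy
    have h2 := congrArg (BoundQuiver.Thread.sigma (s ∘ (P.ribbon.ofIso e).src)) hxy
    simp only [(hL _).thread_start] at h1
    simp only [(hL _).thread_sigma] at h2
    have h3 := (P.ribbon.ofIso e).flip_injective (BoundQuiver.Ribbon.eq_of_vert_eq hs h1 h2)
    exact Subtype.ext (congrArg (fun d : P.ArcSide => d.1) h3)
  · intro H hH
    obtain ⟨d, l', c, rfl, h1, h2, h3⟩ := BoundQuiver.Ribbon.exists_thread_of_isPermitted hs hH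
    obtain ⟨d, rfl⟩ : ∃ d', P.flip d' = d := ⟨P.flip d, P.flip_flip d⟩
    rw [mem_range_turn_iff] at h2
    refine ⟨⟨d.1, d.2, h2⟩, ?_⟩
    simp only
    congr 1
    exact (hL ⟨d.1, d.2, h2⟩).unique h1 (hE _) h3
  · intro x F H' hstep
    obtain ⟨d, l', l'', c, h1, h2, rfl, h3, h4, rfl⟩ :=
      (BoundQuiver.Ribbon.step_thread_iff hs (hL x) (hturn x) (hE x)).1 hstep
    obtain ⟨h5, h6⟩ := startPerm_eq_of_isWalk hP hT hS h1 h2 (hroot x)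
    rw [BoundQuiver.Ribbon.thread_length]
    refine ⟨?_, by omega⟩
    have h7 : (P.ribbon.ofIso e).flip d = _ := heq _ d h5
    rw [h7] at h3 ⊢
    rw [(hL _).unique h3 (hE _) h4]
  · intro x
    obtain ⟨d, L', h1, h2⟩ := hF x
    have h3 := (startPerm_eq_of_isWalk hP hT hS h1 h2 (hroot x)).1
    have h7 : (P.ribbon.ofIso e).flip d = _ := heq _ d h3
    refine ⟨_, (BoundQuiver.Ribbon.step_thread_iff hs (hL x) (hturn x) (hE x)).2
      ⟨d, L', L (startPerm hP hT x), E (startPerm hP hT x), h1, h2, rfl, ?_, hE _, ?_⟩⟩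
    · rw [h7]
      exact hL _
    · rw [h7]
  · exact component_surjective hT
  · exact component_eq_iff hP hT

end Iso

theorem exists_isSignPair (P : PolygonGluing.{u} m) : ∃ σ ε, P.quiver.IsSignPair σ ε := by
  obtain ⟨s, hs⟩ := P.ribbon.exists_signs
  exact ⟨_, _, P.ribbon.isSignPair hs⟩

theorem finsum_pairStar (P : PolygonGluing.{u} m) (n l : ℕ) :
    ∑ᶠ i : P.Component, pairStar (i.numMarkedT : ℤ) i.weightSum n l =
      {i : P.Component | i.numMarkedT = n ∧ i.weightSum = l}.ncard := by
  classical
  have : Fintype P.Component := Fintype.ofFinite _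
  rw [finsum_eq_sum_of_fintype, Set.ncard_eq_toFinset_card', Set.toFinset_ofPred]
  simp only [pairStar, Nat.cast_inj]
  rw [Finset.sum_boole, Nat.cast_id]
  congr 1
  ext i
  simp only [Finset.mem_filter, Finset.mem_univ, true_and, eq_comm]

end PolygonGluing

namespace PolygonGluing

variable {m : ℕ} {P : PolygonGluing.{u} m}

/-! ## Nondegenerate surfaces -/

theorem HasUniqueStarts.isNondegenerate (hS : P.HasUniqueStarts) (hP : P.Terminates)
    (hT : P.HasArcs) : P.IsNondegenerate := by
  intro b b' d d' h h' hd
  apply Subtype.ext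
  refine (Eq.symm h).trans (((piece_eq_iff hP hT d d').2 ?_).trans h')
  refine congrArg Subtype.val (hS (hT.toStart d) (hT.toStart d') ?_)
  change (P.nextArc d.1).1 = (P.nextArc d'.1).1
  rw [nextArc_fst, nextArc_fst, hd]

/-! ### Runs and their first sides -/

theorem run_succ (d : P.ArcSide) (h : P.IsArc (P.succ d.1)) :
    (Quot.mk _ ⟨P.succ d.1, h⟩ : P.Run) = Quot.mk _ d :=
  (Quot.sound (r := fun d d' : P.ArcSide => d'.1 = P.succ d.1) rfl).symm

theorem run_pred (d : P.ArcSide) (h : P.IsArc (P.pred d.1)) :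
    (Quot.mk _ ⟨P.pred d.1, h⟩ : P.Run) = Quot.mk _ d := Quot.sound (P.succ_pred _).symm

/-- Going backwards from `d` meets the given non-arc side. Without one the polygon is internal, and
its run has no first side. -/
theorem exists_start_run (d : P.ArcSide) {i : ZMod (m + 2)} (h : ¬ P.IsArc (d.1.1, i)) :
    ∃ s : P.Start, (Quot.mk _ ⟨s.1, s.2.1⟩ : P.Run) = Quot.mk _ d := by
  obtain ⟨k, -, hk⟩ := P.exists_succ_iterate_eq (d := (d.1.1, i)) (d' := d.1) rfl
  generalize (d.1.1, i) = x at h hk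
  induction k generalizing d with
  | zero =>
    obtain rfl : x = d.1 := hk
    exact absurd d.2 h
  | succ k ih =>
    by_cases hd : P.IsArc (P.pred d.1)
    · rw [← run_pred d hd]
      refine ih ⟨P.pred d.1, hd⟩ ?_
      change _ = P.pred d.1
      rw [← hk, Function.iterate_succ_apply', pred_succ]
    · exact ⟨⟨d.1, d.2, hd⟩, rfl⟩

theorem run_eq_of_forall_isArc {d d' : P.ArcSide} (h : d.1.1 = d'.1.1)
    (hd : ∀ i, P.IsArc (d.1.1, i)) : (Quot.mk _ d : P.Run) = Quot.mk _ d' := by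
  obtain ⟨k, -, hk⟩ := P.exists_succ_iterate_eq h
  clear h
  induction k generalizing d' with
  | zero => exact congrArg _ (Subtype.ext hk)
  | succ k ih =>
    have h1 : P.IsArc (P.succ^[k] d.1) := by
      rw [succ_iterate]
      exact hd _
    rw [ih (d' := ⟨_, h1⟩) rfl]
    exact Quot.sound (by rw [← hk, Function.iterate_succ_apply'])

/-- This is the sense in which cutting leaves a non-degenerate surface unchanged: runs are polygons.
An internal polygon is a single cyclic run; in any other, two runs would give two starts and hence
two segments. -/
theorem IsNondegenerate.bijective_face (h : P.IsNondegenerate) (hP : P.Terminates)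
    (hT : P.HasArcs) : Function.Bijective (Run.face : P.Run → P.Face) := by
  constructor
  · rintro ⟨d⟩ ⟨d'⟩ hd
    have hd : d.1.1 = d'.1.1 := hd
    by_cases hi : ∀ i, P.IsArc (d.1.1, i)
    · exact run_eq_of_forall_isArc hd hi
    · push Not at hi
      obtain ⟨i, hi⟩ := hi
      obtain ⟨s, hs⟩ := exists_start_run d hi
      obtain ⟨s', hs'⟩ := exists_start_run d' (hd ▸ hi)
      have hf := congrArg Run.face hs
      have hf' := congrArg Run.face hs'
      have hss' : s = s' := (segment_bijective hP hT).1 <|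
        h (s.segment hP hT) (s'.segment hP hT) s.bdry s'.bdry rfl rfl (hf.trans (hd.trans hf'.symm))
      subst hss'
      exact hs.symm.trans hs'
  · intro f
    obtain ⟨i, hi⟩ := hT f
    exact ⟨Quot.mk _ ⟨(f, i), hi⟩, rfl⟩

theorem start_eq_of_run_eq {s s' : P.Start}
    (h : (Quot.mk _ ⟨s.1, s.2.1⟩ : P.Run) = Quot.mk _ ⟨s'.1, s'.2.1⟩) : s = s' := by
  -- Being reachable from `s` through arc sides only is invariant under the relation defining runs.
  -- Another start is not reachable in a positive number of steps, since its predecessor is not an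
  -- arc.
  let q : P.ArcSide → Prop := fun d => ∃ k, P.succ^[k] s.1 = d.1 ∧ ∀ i ≤ k, P.IsArc (P.succ^[i] s.1)
  have h1 : q ⟨s.1, s.2.1⟩ ↔ q ⟨s'.1, s'.2.1⟩ := by
    refine (congrArg (Quot.lift q ?_) h).to_iff
    rintro d ⟨_, hd⟩ rfl
    refine propext ⟨fun ⟨k, hk, hk'⟩ => ⟨k + 1, ?_, fun i hi => ?_⟩, fun ⟨k, hk, hk'⟩ => ?_⟩
    · rw [Function.iterate_succ_apply', hk]
    · rcases Nat.le_succ_iff.1 hi with hi | rfl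
      · exact hk' i hi
      · rw [Nat.succ_eq_add_one, Function.iterate_succ_apply', hk]
        exact hd
    · cases k with
      | zero =>
        have h2 : s.1 = P.succ d.1 := hk
        refine absurd ?_ s.2.2
        rw [h2, pred_succ]
        exact d.2
      | succ k =>
        rw [Function.iterate_succ_apply'] at hk
        exact ⟨k, P.succ_injective hk, fun i hi => hk' i (by omega)⟩
  obtain ⟨k, hk, hk'⟩ := h1.1 ⟨0, rfl, fun i hi => by rw [Nat.le_zero.1 hi]; exact s.2.1⟩
  cases k with
  | zero => exact Subtype.ext hk
  | succ k =>
    refine absurd ?_ s'.2.2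
    rw [← show _ = s'.1 from hk, Function.iterate_succ_apply', pred_succ]
    exact hk' k (Nat.le_succ k)

/-! ## The cut surface -/

theorem cutSide_succ (d : P.ArcSide) (h : P.IsArc (P.succ d.1)) :
    P.cutSide ⟨P.succ d.1, h⟩ = P.cut.succ (P.cutSide d) :=
  Prod.ext (run_succ d h) rfl

theorem cutSide_pred (d : P.ArcSide) (h : P.IsArc (P.pred d.1)) :
    P.cutSide ⟨P.pred d.1, h⟩ = P.cut.pred (P.cutSide d) :=
  Prod.ext (run_pred d h) rfl

theorem isArc_cutSide (d : P.ArcSide) : P.cut.IsArc (P.cutSide d) := (P.keep d).2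

theorem exists_cutSide_eq {x : P.cut.Side} (h : P.cut.IsArc x) :
    ∃ d : P.ArcSide, P.cutSide d = x := by
  by_cases hx : Run.HasArc x.1 x.2
  · exact ⟨_, Prod.ext hx.2 rfl⟩
  · exact absurd (dif_neg hx) h

/-- The side of the original surface from which a side of the cut surface comes. -/
def uncut (x : P.cut.Side) : P.Side := (Run.face x.1, x.2)

theorem uncut_succ (x : P.cut.Side) : uncut (P.cut.succ x) = P.succ (uncut x) := rfl

theorem isArc_uncut {x : P.cut.Side} (h : P.cut.IsArc x) : P.IsArc (uncut x) := by
  obtain ⟨d, rfl⟩ := exists_cutSide_eq h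
  exact d.2

theorem uncut_glue {x : P.cut.Side} (h : P.cut.IsArc x) :
    uncut (P.cut.glue x) = P.glue (uncut x) := by
  obtain ⟨d, rfl⟩ := exists_cutSide_eq h
  change uncut (P.cutGlue (P.cutSide d)) = _
  rw [cutGlue_cutSide]
  rfl

/-- Rotation in the cut surface projects to rotation in the original as long as it crosses arcs, so
an endless one would project to an endless one. -/
theorem Terminates.cut (hP : P.Terminates) : P.cut.Terminates := by
  intro x
  by_contra! h
  obtain ⟨k, hk⟩ := hP (uncut x)
  have key : uncut (P.cut.turn^[k] x) = P.turn^[k] (uncut x) := by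
    clear hk
    induction k with
    | zero => rfl
    | succ k ih =>
      rw [Function.iterate_succ_apply', Function.iterate_succ_apply', ← ih, PolygonGluing.turn,
        uncut_glue (h k)]
      rfl
  apply hk
  rw [← key, ← uncut_succ]
  exact isArc_uncut (h k)

theorem hasArcs_cut (P : PolygonGluing.{u} m) : P.cut.HasArcs := by
  rintro ⟨d⟩
  exact ⟨d.1.2, isArc_cutSide d⟩

/-- A polygon of the cut surface is a run, its starts come from starts of that run, and a run has at
most one. -/
theorem hasUniqueStarts_cut (P : PolygonGluing.{u} m) : P.cut.HasUniqueStarts := by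
  have key : ∀ s : P.cut.Start, ∃ s' : P.Start, P.cutSide ⟨s'.1, s'.2.1⟩ = s.1 := fun s => by
    obtain ⟨d, hd⟩ := exists_cutSide_eq s.2.1
    refine ⟨⟨d.1, d.2, fun h => s.2.2 ?_⟩, hd⟩
    rw [← hd, ← cutSide_pred d h]
    exact isArc_cutSide _
  intro s s' h
  obtain ⟨d, hd⟩ := key s
  obtain ⟨d', hd'⟩ := key s'
  apply Subtype.ext
  rw [← hd, ← hd'] at h ⊢
  rw [start_eq_of_run_eq h]

theorem keep_bijective (P : PolygonGluing.{u} m) : Function.Bijective P.keep := by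
  refine ⟨fun d d' h => P.cutSide_injective (congrArg Subtype.val h), fun x => ?_⟩
  obtain ⟨d, hd⟩ := exists_cutSide_eq x.2
  exact ⟨d, Subtype.ext hd⟩

theorem keep_flip (d : P.ArcSide) : P.keep (P.flip d) = P.cut.flip (P.keep d) :=
  Subtype.ext (P.cutGlue_cutSide d).symm

/-- The arrow of the quiver of the cut surface that corresponds to a given arrow. -/
noncomputable def keepArrow (a : P.quiver.A) : P.cut.quiver.A :=
  ⟨P.cutSide ⟨a.1, a.2.1⟩, isArc_cutSide _, by
    rw [← cutSide_succ ⟨a.1, a.2.1⟩ a.2.2]; exact isArc_cutSide _⟩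

theorem keepArrow_bijective (P : PolygonGluing.{u} m) :
    Function.Bijective (keepArrow : P.quiver.A → P.cut.quiver.A) := by
  constructor
  · intro a b h
    have h1 := P.cutSide_injective (congrArg (fun x : P.cut.quiver.A => x.1) h)
    exact Subtype.ext (congrArg (fun x : P.ArcSide => x.1) h1)
  · intro x
    obtain ⟨d, hd⟩ := exists_cutSide_eq x.2.1
    refine ⟨⟨d.1, d.2, ?_⟩, Subtype.ext hd⟩
    have h := isArc_uncut x.2.2
    rw [uncut_succ, ← hd] at h
    exact h

/-- Cutting out the boundary bridges does not change the bound quiver. -/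
noncomputable def cutIso (P : PolygonGluing.{u} m) : P.quiver.Iso P.cut.quiver where
  vertex := Quot.congr (Equiv.ofBijective _ P.keep_bijective) fun d d' => by
    rw [Equiv.ofBijective_apply, Equiv.ofBijective_apply, ← keep_flip,
      P.keep_bijective.1.eq_iff]
  arrow := Equiv.ofBijective _ P.keepArrow_bijective
  s_arrow _ := rfl
  t_arrow a := congrArg P.cut.arc (Subtype.ext (cutSide_succ ⟨a.1, a.2.1⟩ a.2.2).symm)
  rel_arrow a b := by
    change P.cutSide ⟨b.1, b.2.1⟩ = P.cut.succ (P.cutSide ⟨a.1, a.2.1⟩) ↔ b.1 = P.succ a.1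
    rw [← cutSide_succ ⟨a.1, a.2.1⟩ a.2.2, P.cutSide_injective.eq_iff, Subtype.mk.injEq]

/-! ## Cycles with full relations -/

theorem getElem_of_isChain_rel {a : P.quiver.A} {l : List P.quiver.A}
    (h : (a :: l).IsChain P.quiver.rel) (i : ℕ) (hi : i < (a :: l).length) :
    (a :: l)[i].1 = P.succ^[i] a.1 := by
  induction l generalizing a i with
  | nil =>
    obtain rfl : i = 0 := by simpa using hi
    rfl
  | cons b l ih =>
    rw [List.isChain_cons_cons] at h
    cases i with
    | zero => rfl
    | succ i =>
      rw [Function.iterate_succ_apply, ← show b.1 = P.succ a.1 from h.1]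
      exact ih h.2 i (by simpa using hi)

theorem exists_of_mem_relationCycles {n : ℕ} {c : Cycle P.quiver.A}
    (h : c ∈ P.quiver.relationCycles n) {a : P.quiver.A} (ha : a ∈ c) :
    ∃ l : List P.quiver.A, c = (a :: l : List P.quiver.A) ∧ (a :: l).Nodup ∧
      (a :: (l ++ [a])).IsChain P.quiver.rel ∧ l.length + 1 = n := by
  obtain ⟨L, rfl⟩ := Quot.exists_rep c
  obtain ⟨l₁, l₂, rfl⟩ := List.append_of_mem (Cycle.mem_coe_iff.1 ha)
  have hc : (Quot.mk _ (l₁ ++ a :: l₂) : Cycle P.quiver.A) =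
      ((a :: (l₂ ++ l₁) : List P.quiver.A) : Cycle P.quiver.A) :=
    Quot.sound ⟨l₁.length, by simp⟩
  obtain ⟨-, h1, h2, h3⟩ := h
  rw [hc] at h1 h2 h3 ⊢
  exact ⟨_, rfl, h1, (Cycle.chain_coe_cons _ _ _).1 h2, h3⟩

/-- Relations advance by one side in a fixed polygon. Closing up forces `m + 2` to divide the
length, and distinctness of the arrows forbids more than one turn. -/
theorem length_of_mem_relationCycles {n : ℕ} {c : Cycle P.quiver.A}
    (h : c ∈ P.quiver.relationCycles n) : n = m + 2 := by
  obtain ⟨a, ha⟩ : ∃ a, a ∈ c := by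
    induction c using Cycle.induction_on with
    | nil => exact absurd rfl h.1
    | cons a l => exact ⟨a, by simp⟩
  obtain ⟨l, rfl, hn, hc, rfl⟩ := exists_of_mem_relationCycles h ha
  have h1 := getElem_of_isChain_rel hc (l.length + 1) (by simp)
  have h2 : m + 2 ∣ l.length + 1 := by
    have h3 : (a :: (l ++ [a]))[l.length + 1]'(by simp) = a := by simp
    rw [h3, succ_iterate] at h1
    have := congrArg Prod.snd h1
    rw [eq_comm] at this
    simp only [add_eq_left] at this
    exact (ZMod.natCast_eq_zero_iff _ _).1 this
  apply le_antisymm _ (Nat.le_of_dvd (Nat.succ_pos _) h2)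
  by_contra! h3
  have h4 := getElem_of_isChain_rel hc (m + 2) (by simp; omega)
  rw [succ_iterate, ZMod.natCast_self, add_zero] at h4
  have h5 : (a :: (l ++ [a]))[m + 2]'(by simp; omega) = (a :: l)[m + 2] := by
    simp only [← List.cons_append]
    rw [List.getElem_append_left]
  rw [h5] at h4
  have h6 : (a :: l)[m + 2] = (a :: l)[0] := Subtype.ext h4
  have := (hn.getElem_inj_iff).1 h6
  omega

/-- Starting at `a`, the arrow in position `i` must be the angle after the `i`-th successor of the
side of `a`. -/
theorem eq_of_mem_relationCycles {n : ℕ} {c c' : Cycle P.quiver.A}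
    (h : c ∈ P.quiver.relationCycles n) (h' : c' ∈ P.quiver.relationCycles n) {a : P.quiver.A}
    (ha : a ∈ c) (ha' : a ∈ c') : c = c' := by
  obtain ⟨l, rfl, -, hc, hl⟩ := exists_of_mem_relationCycles h ha
  obtain ⟨l', rfl, -, hc', hl'⟩ := exists_of_mem_relationCycles h' ha'
  rw [← List.cons_append] at hc hc'
  congr 1
  apply List.ext_getElem (by simp; omega)
  intro i h1 h2
  apply Subtype.ext
  rw [getElem_of_isChain_rel hc.left_of_append, getElem_of_isChain_rel hc'.left_of_append]

theorem isArc_of_mem_relationCycles {n : ℕ} {c : Cycle P.quiver.A}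
    (h : c ∈ P.quiver.relationCycles n) {a : P.quiver.A} (ha : a ∈ c) (i : ZMod (m + 2)) :
    P.IsArc (a.1.1, i) := by
  obtain rfl := length_of_mem_relationCycles h
  obtain ⟨l, rfl, -, hc, hl⟩ := exists_of_mem_relationCycles h ha
  obtain ⟨k, hk, hk'⟩ := P.exists_succ_iterate_eq (d := a.1) (d' := (a.1.1, i)) rfl
  rw [← hk', ← getElem_of_isChain_rel hc k (by simp; omega)]
  exact Subtype.property (p := fun d => P.IsArc d ∧ P.IsArc (P.succ d)) _ |>.1

/-- The arrows in an internal polygon. -/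
def internalArrow (f : {f : P.Face // ∀ i, P.IsArc (f, i)}) (i : ZMod (m + 2)) : P.quiver.A :=
  ⟨(f.1, i), f.2 _, f.2 _⟩

theorem internalArrow_val (f : {f : P.Face // ∀ i, P.IsArc (f, i)}) (i : ZMod (m + 2)) :
    (internalArrow f i).1 = (f.1, i) := rfl

/-- The cycle of arrows in an internal polygon. -/
def internalCycle (f : {f : P.Face // ∀ i, P.IsArc (f, i)}) : Cycle P.quiver.A :=
  ((List.range (m + 2)).map fun i : ℕ => internalArrow f i : List P.quiver.A)

theorem internalCycle_mem (f : {f : P.Face // ∀ i, P.IsArc (f, i)}) :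
    internalCycle f ∈ P.quiver.relationCycles (m + 2) := by
  refine ⟨?_, ?_, ?_, ?_⟩
  · intro h
    have := congrArg Cycle.length h
    simp [internalCycle] at this
  · rw [internalCycle, Cycle.nodup_coe_iff]
    refine List.nodup_range.map_on fun i hi j hj h => ?_
    have h1 := congrArg (fun x : P.quiver.A => x.1.2) h
    simp only [internalArrow_val, ZMod.natCast_eq_natCast_iff'] at h1
    rwa [Nat.mod_eq_of_lt (List.mem_range.1 hi), Nat.mod_eq_of_lt (List.mem_range.1 hj)] at h1
  · rw [internalCycle, ← Cycle.map_coe, Cycle.chain_map, Cycle.chain_range_succ]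
    have key : ∀ i j : ℕ, ((j : ZMod (m + 2)) = i + 1) →
        P.quiver.rel (internalArrow f i) (internalArrow f j) := fun i j h => Prod.ext rfl h
    refine ⟨key _ _ ?_, fun i _ => key _ _ (by simp)⟩
    have := ZMod.natCast_self (m + 2)
    push_cast at this ⊢
    rw [← this]
    ring
  · simp [internalCycle]

theorem fst_of_mem_internalCycle {f : {f : P.Face // ∀ i, P.IsArc (f, i)}} {a : P.quiver.A}
    (h : a ∈ internalCycle f) : a.1.1 = f.1 := by
  rw [internalCycle, Cycle.mem_coe_iff, List.mem_map] at h
  obtain ⟨i, -, rfl⟩ := h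
  rfl

theorem zero_mem_internalCycle (f : {f : P.Face // ∀ i, P.IsArc (f, i)}) :
    internalArrow f 0 ∈ internalCycle f := by
  rw [internalCycle, Cycle.mem_coe_iff, List.mem_map]
  exact ⟨0, by simp, by simp⟩

theorem ncard_relationCycles (P : PolygonGluing.{u} m) (l : ℕ) :
    (P.quiver.relationCycles l).ncard = if l = m + 2 then P.numInternal else 0 := by
  split_ifs with h
  · subst h
    have hinj : Function.Injective
        (internalCycle : {f : P.Face // ∀ i, P.IsArc (f, i)} → Cycle P.quiver.A) := fun f f' h => by
      have := zero_mem_internalCycle f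
      rw [h] at this
      exact Subtype.ext (fst_of_mem_internalCycle this)
    rw [numInternal, ← Set.ncard_univ, ← Set.ncard_image_of_injective _ hinj, Set.image_univ]
    congr 1
    ext c
    constructor
    · intro hc
      obtain ⟨a, ha⟩ : ∃ a, a ∈ c := by
        induction c using Cycle.induction_on with
        | nil => exact absurd rfl hc.1
        | cons a l => exact ⟨a, by simp⟩
      let f : {f : P.Face // ∀ i, P.IsArc (f, i)} := ⟨a.1.1, isArc_of_mem_relationCycles hc ha⟩
      have hf := internalCycle_mem f
      refine ⟨f, eq_of_mem_relationCycles hf hc (zero_mem_internalCycle f) ?_⟩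
      obtain ⟨l, rfl, -, hl, hlen⟩ := exists_of_mem_relationCycles hc ha
      obtain ⟨k, hk, hk'⟩ := P.exists_succ_iterate_eq (d := a.1) (d' := (a.1.1, 0)) rfl
      rw [← List.cons_append] at hl
      rw [Cycle.mem_coe_iff]
      convert List.getElem_mem (l := a :: l) (n := k) (by simp; omega)
      apply Subtype.ext
      rw [getElem_of_isChain_rel hl.left_of_append, hk']
      rfl
    · rintro ⟨f, rfl⟩
      exact internalCycle_mem f
  · rw [Set.eq_empty_of_forall_notMem fun c hc => h (length_of_mem_relationCycles hc),
      Set.ncard_empty]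

end PolygonGluing

/-! ### Assembly of the theorem -/

theorem mainTheorem4 (m : ℕ) (hm : 1 ≤ m) (P : PolygonGluing.{u} m) (hP : P.IsAngulation)
    (hT : ∀ f : P.Face, ∃ i : ZMod (m + 2), P.IsArc (f, i)) :
    P.cut.IsAngulation ∧ P.cut.IsNondegenerate ∧
    (P.IsNondegenerate → Function.Bijective (PolygonGluing.Run.face : P.Run → P.Face)) ∧
    (∃ e : BoundQuiver.Iso P.quiver P.cut.quiver,
      (∀ d : P.ArcSide, e.vertex (P.arc d) = P.cut.arc (P.keep d)) ∧
      (∀ a : P.quiver.A, (e.arrow a).1 = (P.keep ⟨a.1, a.2.1⟩).1)) ∧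
    P.quiver.IsGentle ∧
    P.quiver.HasAGInvariant (fun x y =>
      P.numInternal * pairStar 0 ((m : ℤ) + 2) x y +
        ∑ᶠ i : P.cut.Component, pairStar (i.numMarkedT : ℤ) i.weightSum x y) := by
  have hP := PolygonGluing.isAngulation_iff_terminates.1 hP
  refine ⟨PolygonGluing.isAngulation_iff_terminates.2 hP.cut,
    P.hasUniqueStarts_cut.isNondegenerate hP.cut P.hasArcs_cut,
    fun h => h.bijective_face hP hT, ⟨P.cutIso, fun _ => rfl, fun _ => rfl⟩,
    PolygonGluing.isGentle_of_iso P.cutIso hP.cut, P.exists_isSignPair, fun σ ε h n l => ?_⟩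
  beta_reduce
  rw [BoundQuiver.ag, PolygonGluing.ncard_agOrbits_eq P.cutIso hP.cut P.hasArcs_cut
    P.hasUniqueStarts_cut h, P.cut.finsum_pairStar, P.ncard_relationCycles, add_comm]
  congr 1
  have h1 : ((l : ℤ) = (m : ℤ) + 2) ↔ l = m + 2 := by omega
  simp only [pairStar, Nat.cast_eq_zero, h1]
  by_cases hn : n = 0 <;> by_cases hl : l = m + 2 <;> simp [hn, hl]
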